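/- **Conventions.** For a poset $X$ and $x\in X$ put $U_x=\{y\in X: y\le x\}$, $\widehat U_x=\{y\in X : y<x\}$ and $\widehat F_x=\{y\in X : y>x\}$; if the poset has to be specified we write $\widehat U_x^X$. For $n\ge 0$ an $n$-chain of $X$ is a totally ordered subset of $X$ with $n+1$ elements, and $\mathrm{Ch}_n(X)$ is the set of $n$-chains; moreover $\mathrm{Ch}_{-1}(X)=\{\varnothing\}$ for reduced homology. For an abelian group $G$ and $n\in\mathbb Z$, $\widetilde H_n(X;G)$ is the reduced simplicial homology of the order complex of $X$, i.e. the homology of the augmented complex $\bigoplus_{s\in \mathrm{Ch}_n(X)}G$ $(n\geq -1)$ with $d(a\,s)=\sum_k(-1)^k a\,(s-\{s_k\})$ for $s=\{s_0<\dots<s_n\}$ (so $\widetilde H_{-1}(\varnothing;G)=G$), and $\widetilde H_n(X)=\widetilde H_n(X;\mathbb Z)$. For a functor $\mathcal F\colon X\to\mathcal{A}b$, $H_n(X;\mathcal F)$ is the $n$-th homology group of the complex $C_n(X;\mathcal F)=\bigoplus_{\sigma\in \mathrm{Ch}_n(X)}\mathcal F(\min\sigma)$ ($n\ge 0$; zero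 for $n<0$) with $$d(a\,\sigma)=\mathcal F(\sigma_0\le\sigma_1)(a)\,(\sigma-\{\sigma_0\})+\sum_{k\ge1}(-1)^k a\,(\sigma-\{\sigma_k\})\quad\text{in degrees } n\geq 1 .$$ A poset $X$ is *quasicellular* with *quasicellular morphism* $\rho$ if $U_x$ is finite for all $x\in X$ and $\rho\colon X\to\mathbb N_0$ is an order preserving map such that $\{x:\rho(x)=n\}$ is an antichain for every $n\in\mathbb N_0$ and, for every $x\in X$, $\widetilde H_k(\widehat U_x)=0$ for all $k\neq\rho(x)-1$. **Theorem.** Let $P$ be a poset such that $P^{op}$ is quasicellular with quasicellular morphism $\rho\colon P^{op}\to\mathbb N_0$, and suppose that $\widetilde H_{\rho(x)-1}(\widehat U_x^{P^{op}})$ is a free abelian group for all $x\in P$. For $n\in\mathbb Z$ let $D_n=\{x\in P:\rho(x)=n\}$. Let $\mathcal F\colon P\to\mathcal{A}b$ be a functor and let $\mathcal C^{P,\mathcal F}$ be the chain complex with $$C^{P,\mathcal F}_n=\bigoplus_{x\in D_n}\widetilde H_{n-1}(\widehat F_x;\mathcal F(x)),\qquad n\in\mathbb Z,$$ and differentials $d_n\colon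 C^{P,\mathcal F}_n\to C^{P,\mathcal F}_{n-1}$ given by $$d_n\left(\Big(\Big[\sum_{i=1}^{l_x}a^x_i s^x_i\Big]\Big)_{x\in D_n}\right)=\left(\Big[\sum_{x\in D_n}\ \sum_{i\,:\,s^x_i\ni y}\mathcal F(x\le y)(a^x_i)\,(s^x_i-\{y\})\Big]\right)_{y\in D_{n-1}},$$ where $\sum_{i=1}^{l_x} a^x_i s^x_i$ is a cycle with $a^x_i\in\mathcal F(x)$ and $s^x_i\in\mathrm{Ch}_{n-1}(\widehat F_x)$, for each $x\in D_n$ (almost all of the classes being zero). Then $H_n(P;\mathcal F)\cong H_n(\mathcal C^{P,\mathcal F})$ for all $n\in\mathbb Z$. -/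

import Mathlib

open CategoryTheory

universe u v

namespace PosetHomology

open scoped Classical in
/-- The sign `(-1)^k` of deleting `w` from the chain `s = {s₀ < s₁ < ⋯ < sₙ}`, where `w = s_k`,
that is, `k` is the number of elements of `s` that are smaller than `w`. -/
noncomputable def faceSign {X : Type u} [PartialOrder X] (s : Finset X) (w : X) : ℤ :=
  (-1) ^ (s.filter (fun z => z < w)).card

section Reduced

variable {X : Type u} [PartialOrder X]

/-- `s` is an `n`-chain of the subposet `A`: a totally ordered subset of `A` with `n + 1` elements.
The empty set is the unique `(-1)`-chain, and there are no `n`-chains for `n < -1`. -/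
def IsChainOf (A : Set X) (n : ℤ) (s : Finset X) : Prop :=
  (s : Set X) ⊆ A ∧ IsChain (· ≤ ·) (s : Set X) ∧ (s.card : ℤ) = n + 1

/-- The set `Ch_n(A)` of `n`-chains of the subposet `A` (with the empty chain in degree `-1`). -/
abbrev Chains (A : Set X) (n : ℤ) : Type u := {s : Finset X // IsChainOf A n s}

open scoped Classical in
/-- `chainTerm A G n s a` is the element `a • s` of `⨁_{Ch_n(A)} G`, where `s` is an `n`-chain of `A`
(and it is `0` if `s` is not an `n`-chain of `A`). -/
noncomputable def chainTerm (A : Set X) (G : Type v) [AddCommGroup G] (n : ℤ) (s : Finset X) :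
    G →+ (Chains A n →₀ G) :=
  if h : IsChainOf A n s then Finsupp.singleAddHom ⟨s, h⟩ else 0

open scoped Classical in
/-- The simplicial boundary `a • s ↦ ∑_k (-1)^k a • (s - {s_k})` from degree `i` to degree `j`.
It is only of interest for `j + 1 = i`, and it is zero otherwise. In degree `0` it is the
augmentation `a • {w} ↦ a • ∅`. -/
noncomputable def reducedBoundary (A : Set X) (G : Type v) [AddCommGroup G] (i j : ℤ) :
    (Chains A i →₀ G) →+ (Chains A j →₀ G) :=
  Finsupp.liftAddHom fun s =>
    ∑ w ∈ s.1, faceSign s.1 w • chainTerm A G j (s.1.erase w)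

open scoped Classical in
lemma faceSign_mul_faceSign (s : Finset X) (hs : IsChain (· ≤ ·) (s : Set X)) (a b : X)
    (ha : a ∈ s) (hb : b ∈ s) (hab : a ≠ b) :
    faceSign s a * faceSign (s.erase a) b = -(faceSign s b * faceSign (s.erase b) a) := by
  have key : ∀ a b : X, a ∈ s → b ∈ s → a < b →
      faceSign s a * faceSign (s.erase a) b = -(faceSign s b * faceSign (s.erase b) a) := by
    intro a b ha hb hab
    have h1 : (s.erase b).filter (fun z => z < a) = s.filter (fun z => z < a) := by
      ext z
      simp only [Finset.mem_filter, Finset.mem_erase]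
      constructor
      · rintro ⟨⟨_, h⟩, h'⟩; exact ⟨h, h'⟩
      · rintro ⟨h, h'⟩; exact ⟨⟨(h'.trans hab).ne, h⟩, h'⟩
    have h2 : (s.erase a).filter (fun z => z < b) = (s.filter (fun z => z < b)).erase a := by
      ext z
      simp only [Finset.mem_filter, Finset.mem_erase]
      tauto
    have h3 : a ∈ s.filter (fun z => z < b) := by simp [ha, hab]
    have h4 := Finset.card_erase_add_one h3
    unfold faceSign
    rw [h1, h2, ← h4, pow_succ]
    ring
  rcases hs ha hb hab with h | h
  · exact key a b ha hb (lt_of_le_of_ne h hab)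
  · rw [key b a hb ha (lt_of_le_of_ne h hab.symm), neg_neg]

open scoped Classical in
lemma sum_sum_faceSign {M : Type*} [AddCommGroup M] (s : Finset X)
    (hs : IsChain (· ≤ ·) (s : Set X)) (f : Finset X → M) :
    ∑ a ∈ s, faceSign s a • ∑ b ∈ s.erase a, faceSign (s.erase a) b •
      f ((s.erase a).erase b) = 0 := by
  simp only [Finset.smul_sum, smul_smul]
  rw [Finset.sum_sigma']
  refine Finset.sum_involution (fun p _ => ⟨p.2, p.1⟩) ?_ ?_ ?_ ?_
  · rintro ⟨a, b⟩ h
    simp only [Finset.mem_sigma, Finset.mem_erase] at h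
    simp only
    rw [faceSign_mul_faceSign s hs a b h.1 h.2.2 (Ne.symm h.2.1),
      Finset.erase_right_comm (s := s) (a := b) (b := a), neg_smul, neg_add_cancel]
  · rintro ⟨a, b⟩ h _ h'
    simp only [Finset.mem_sigma, Finset.mem_erase] at h
    simp only [Sigma.mk.injEq] at h'
    exact h.2.1 h'.1
  · rintro ⟨a, b⟩ h
    simp only [Finset.mem_sigma, Finset.mem_erase] at h ⊢
    exact ⟨h.2.2, Ne.symm h.2.1, h.1⟩
  · rintro ⟨a, b⟩ h
    rfl

open scoped Classical in
lemma IsChainOf.erase {A : Set X} {i j : ℤ} {s : Finset X} (hs : IsChainOf A i s)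
    (hij : j + 1 = i) {w : X} (hw : w ∈ s) : IsChainOf A j (s.erase w) := by
  refine ⟨?_, hs.2.1.mono ?_, ?_⟩
  · intro z hz
    exact hs.1 (Finset.mem_of_mem_erase (Finset.mem_coe.1 hz))
  · intro z hz
    exact Finset.mem_of_mem_erase (Finset.mem_coe.1 hz)
  · have h1 := Finset.card_erase_add_one hw
    have h2 := hs.2.2
    omega

open scoped Classical in
lemma reducedBoundary_chainTerm (A : Set X) (G : Type v) [AddCommGroup G] (i j : ℤ)
    (s : Finset X) (hs : IsChainOf A i s) (a : G) :
    reducedBoundary A G i j (chainTerm A G i s a) =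
      ∑ w ∈ s, faceSign s w • chainTerm A G j (s.erase w) a := by
  rw [chainTerm, dif_pos hs]
  simp [reducedBoundary]

lemma reducedBoundary_eq_zero (A : Set X) (G : Type v) [AddCommGroup G] (i j : ℤ)
    (hij : j + 1 ≠ i) : reducedBoundary A G i j = 0 := by
  classical
  refine Finsupp.addHom_ext fun s a => ?_
  simp only [reducedBoundary, Finsupp.liftAddHom_apply_single, AddMonoidHom.zero_apply,
    AddMonoidHom.finsetSum_apply, AddMonoidHom.smul_apply]
  refine Finset.sum_eq_zero fun w hw => ?_
  have : ¬ IsChainOf A j (s.1.erase w) := by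
    intro h
    have h1 := Finset.card_erase_add_one hw
    have h2 := s.2.2.2
    have h3 := h.2.2
    omega
  rw [chainTerm, dif_neg this]
  simp

lemma reducedBoundary_comp (A : Set X) (G : Type v) [AddCommGroup G] (i j k : ℤ)
    (hij : j + 1 = i) :
    (reducedBoundary A G j k).comp (reducedBoundary A G i j) = 0 := by
  classical
  refine Finsupp.addHom_ext fun s a => ?_
  have h0 : Finsupp.single s a = chainTerm A G i s.1 a := by
    rw [chainTerm, dif_pos s.2]; rfl
  rw [AddMonoidHom.comp_apply, h0, reducedBoundary_chainTerm A G i j s.1 s.2, map_sum]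
  have h1 : ∀ w ∈ s.1, reducedBoundary A G j k (faceSign s.1 w •
      chainTerm A G j (s.1.erase w) a) = faceSign s.1 w • ∑ z ∈ s.1.erase w,
        faceSign (s.1.erase w) z • chainTerm A G k ((s.1.erase w).erase z) a := by
    intro w hw
    rw [map_zsmul, reducedBoundary_chainTerm A G j k _ (s.2.erase hij hw)]
  rw [Finset.sum_congr rfl h1]
  exact sum_sum_faceSign s.1 s.2.2.1 (fun t => chainTerm A G k t a)

/-- The augmented simplicial chain complex, with coefficients in the abelian group `G`, of the order
complex of the subposet `A`. -/
noncomputable def reducedComplex (A : Set X) (G : Type v) [AddCommGroup G] :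
    ChainComplex AddCommGrpCat.{max u v} ℤ where
  X n := AddCommGrpCat.of (Chains A n →₀ G)
  d i j := AddCommGrpCat.ofHom (reducedBoundary A G i j)
  shape i j hij := by
    rw [reducedBoundary_eq_zero A G i j hij]
    rfl
  d_comp_d' i j k hij _ := by
    rw [← AddCommGrpCat.ofHom_comp, reducedBoundary_comp A G i j k hij]
    rfl

/-- The reduced homology group `H̃_n(A; G)` of the subposet `A`, for `n ∈ ℤ`. -/
noncomputable abbrev reducedHomology (A : Set X) (G : Type v) [AddCommGroup G] (n : ℤ) :
    AddCommGrpCat.{max u v} :=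
  (reducedComplex A G).homology n

/-- `ρ` is a quasicellular morphism for the poset `X` (which is part of the data of an order
preserving map): `X` is locally finite, i.e. every minimal open set `U_x = {y | y ≤ x}` is finite;
the fibres of `ρ` are antichains; and the reduced integral homology of `Û_x = {y | y < x}` is
concentrated in degree `ρ x - 1`. -/
structure IsQuasicellularMorphism (ρ : X →o ℕ) : Prop where
  locallyFinite : ∀ x : X, (Set.Iic x).Finite
  antichain : ∀ n : ℕ, IsAntichain (· ≤ ·) {x : X | ρ x = n}
  concentrated : ∀ (x : X) (k : ℤ), k ≠ (ρ x : ℤ) - 1 →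
    Subsingleton (reducedHomology (Set.Iio x) ℤ k)

lemma IsQuasicellularMorphism.lt {ρ : X →o ℕ} (hρ : IsQuasicellularMorphism ρ) {x y : X}
    (h : x < y) : ρ x < ρ y := by
  refine lt_of_le_of_ne (ρ.monotone h.le) fun he => ?_
  exact hρ.antichain (ρ y) he rfl h.ne h.le

end Reduced

section FunctorCoefficients

variable {P : Type u} [PartialOrder P]

/-- `s` is an `n`-chain of `P` (hence non-empty): a non-empty totally ordered subset of `P` with
`n + 1` elements. -/
def IsNonemptyChain (P : Type u) [PartialOrder P] (n : ℤ) (s : Finset P) : Prop :=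
  s.Nonempty ∧ IsChain (· ≤ ·) (s : Set P) ∧ (s.card : ℤ) = n + 1

/-- The set `Ch_n(P)` of non-empty `n`-chains of `P`; it is empty for `n < 0`. -/
abbrev NonemptyChains (P : Type u) [PartialOrder P] (n : ℤ) : Type u :=
  {s : Finset P // IsNonemptyChain P n s}

lemma IsNonemptyChain.exists_isLeast {n : ℤ} {s : Finset P} (hs : IsNonemptyChain P n s) :
    ∃ m, IsLeast (s : Set P) m := by
  obtain ⟨m, hm, hmin⟩ := s.exists_minimal hs.1
  refine ⟨m, hm, fun w hw => ?_⟩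
  rcases hs.2.1.total hm hw with h | h
  · exact h
  · exact hmin hw h

/-- The minimum `min σ` of a non-empty chain. -/
noncomputable def chainMin {n : ℤ} (σ : NonemptyChains P n) : P :=
  σ.2.exists_isLeast.choose

lemma chainMin_isLeast {n : ℤ} (σ : NonemptyChains P n) :
    IsLeast (σ.1 : Set P) (chainMin σ) :=
  σ.2.exists_isLeast.choose_spec

/-- The group `C_n(P; F) = ⨁_{σ ∈ Ch_n(P)} F(min σ)`. -/
abbrev FunctorChains (F : P ⥤ AddCommGrpCat.{v}) (n : ℤ) : Type (max u v) :=
  DirectSum (NonemptyChains P n) fun σ => F.obj (chainMin σ)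

open scoped Classical in
/-- `functorChainTerm F n s p a`, for an element `p ≤ min s` and `a ∈ F(p)`, is the element
`F(p ≤ min s)(a) • s` of `C_n(P; F)` (and it is `0` if `s` is not a non-empty `n`-chain or `p` is
not a lower bound of it). -/
noncomputable def functorChainTerm (F : P ⥤ AddCommGrpCat.{v}) (n : ℤ) (s : Finset P) (p : P) :
    F.obj p →+ FunctorChains F n :=
  if h : ∃ hs : IsNonemptyChain P n s, p ≤ chainMin ⟨s, hs⟩ then
    (DirectSum.of (fun σ : NonemptyChains P n => F.obj (chainMin σ)) ⟨s, h.1⟩).comp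
      (F.map (homOfLE h.2)).hom
  else 0

open scoped Classical in
/-- The differential
`a • σ ↦ F(σ₀ < σ₁)(a) • (σ - {σ₀}) + ∑_{k ≥ 1} (-1)^k a • (σ - {σ_k})`, written uniformly as
`∑_k (-1)^k F(min σ ≤ min (σ - {σ_k}))(a) • (σ - {σ_k})`, from degree `i` to degree `j`.
It is only of interest for `j + 1 = i`, and it is zero otherwise. -/
noncomputable def functorBoundary (F : P ⥤ AddCommGrpCat.{v}) (i j : ℤ) :
    FunctorChains F i →+ FunctorChains F j :=
  DirectSum.toAddMonoid fun σ =>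
    ∑ w ∈ σ.1, faceSign σ.1 w • functorChainTerm F j (σ.1.erase w) (chainMin σ)

open scoped Classical in
lemma functorChainTerm_eq (F : P ⥤ AddCommGrpCat.{v}) (n : ℤ) (s : Finset P) (p : P)
    (hs : IsNonemptyChain P n s) (hp : p ≤ chainMin ⟨s, hs⟩) (a : F.obj p) :
    functorChainTerm F n s p a =
      DirectSum.of (fun σ : NonemptyChains P n => F.obj (chainMin σ)) ⟨s, hs⟩
        ((F.map (homOfLE hp)).hom a) := by
  rw [functorChainTerm, dif_pos ⟨hs, hp⟩]
  rfl

lemma functorChainTerm_eq_zero (F : P ⥤ AddCommGrpCat.{v}) (n : ℤ) (s : Finset P) (p : P)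
    (hs : ¬ IsNonemptyChain P n s) : functorChainTerm F n s p = 0 := by
  rw [functorChainTerm, dif_neg]
  rintro ⟨h, _⟩
  exact hs h

lemma functorChainTerm_map (F : P ⥤ AddCommGrpCat.{v}) (n : ℤ) (s : Finset P) (p q : P)
    (hpq : p ≤ q) (hq : ∀ w ∈ s, q ≤ w) (a : F.obj p) :
    functorChainTerm F n s q ((F.map (homOfLE hpq)).hom a) = functorChainTerm F n s p a := by
  by_cases hs : IsNonemptyChain P n s
  · have h1 : q ≤ chainMin ⟨s, hs⟩ := hq _ (chainMin_isLeast ⟨s, hs⟩).1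
    rw [functorChainTerm_eq F n s q hs h1, functorChainTerm_eq F n s p hs (hpq.trans h1)]
    congr 1
    rw [← AddCommGrpCat.comp_apply, ← F.map_comp]
    rfl
  · rw [functorChainTerm_eq_zero F n s q hs, functorChainTerm_eq_zero F n s p hs]
    rfl

open scoped Classical in
lemma functorBoundary_functorChainTerm (F : P ⥤ AddCommGrpCat.{v}) (i j : ℤ) (s : Finset P) (p : P)
    (hs : IsNonemptyChain P i s) (hp : ∀ w ∈ s, p ≤ w) (a : F.obj p) :
    functorBoundary F i j (functorChainTerm F i s p a) =
      ∑ w ∈ s, faceSign s w • functorChainTerm F j (s.erase w) p a := by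
  have h1 : p ≤ chainMin ⟨s, hs⟩ := hp _ (chainMin_isLeast ⟨s, hs⟩).1
  rw [functorChainTerm_eq F i s p hs h1, functorBoundary, DirectSum.toAddMonoid_of]
  simp only [AddMonoidHom.finsetSum_apply, AddMonoidHom.smul_apply]
  refine Finset.sum_congr rfl fun w _ => ?_
  rw [functorChainTerm_map F j _ p _ h1]
  intro z hz
  exact (chainMin_isLeast ⟨s, hs⟩).2 (Finset.mem_of_mem_erase hz)

lemma functorBoundary_eq_zero (F : P ⥤ AddCommGrpCat.{v}) (i j : ℤ)
    (hij : j + 1 ≠ i) : functorBoundary F i j = 0 := by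
  classical
  refine DirectSum.addHom_ext fun σ a => ?_
  simp only [functorBoundary, DirectSum.toAddMonoid_of, AddMonoidHom.zero_apply,
    AddMonoidHom.finsetSum_apply, AddMonoidHom.smul_apply]
  refine Finset.sum_eq_zero fun w hw => ?_
  have : ¬ IsNonemptyChain P j (σ.1.erase w) := by
    intro h
    have h1 := Finset.card_erase_add_one hw
    have h2 := σ.2.2.2
    have h3 := h.2.2
    omega
  rw [functorChainTerm_eq_zero F _ _ _ this]
  simp

lemma functorBoundary_comp (F : P ⥤ AddCommGrpCat.{v}) (i j k : ℤ) (hij : j + 1 = i) :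
    (functorBoundary F j k).comp (functorBoundary F i j) = 0 := by
  classical
  refine DirectSum.addHom_ext fun σ a => ?_
  have hmin := chainMin_isLeast σ
  have h0 : functorBoundary F i j
      (DirectSum.of (fun σ : NonemptyChains P i => F.obj (chainMin σ)) σ a) =
        ∑ w ∈ σ.1, faceSign σ.1 w • functorChainTerm F j (σ.1.erase w) (chainMin σ) a := by
    rw [functorBoundary, DirectSum.toAddMonoid_of]
    simp only [AddMonoidHom.finsetSum_apply, AddMonoidHom.smul_apply]
  rw [AddMonoidHom.comp_apply, h0]
  simp only [map_sum, map_zsmul]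
  have h1 : ∀ w ∈ σ.1, functorBoundary F j k
      (functorChainTerm F j (σ.1.erase w) (chainMin σ) a) = ∑ z ∈ σ.1.erase w,
        faceSign (σ.1.erase w) z •
          functorChainTerm F k ((σ.1.erase w).erase z) (chainMin σ) a := by
    intro w hw
    by_cases hne : (σ.1.erase w).Nonempty
    · refine functorBoundary_functorChainTerm F j k _ _ ⟨hne, ?_, ?_⟩ ?_ a
      · refine σ.2.2.1.mono fun z hz => ?_
        exact Finset.mem_of_mem_erase (Finset.mem_coe.1 hz)
      · have h1 := Finset.card_erase_add_one hw
        have h2 := σ.2.2.2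
        omega
      · intro z hz
        exact hmin.2 (Finset.mem_of_mem_erase hz)
    · rw [functorChainTerm_eq_zero F _ _ _ (fun h => hne h.1),
        Finset.not_nonempty_iff_eq_empty.1 hne]
      simp
  rw [Finset.sum_congr rfl fun w hw => by rw [h1 w hw]]
  exact sum_sum_faceSign σ.1 σ.2.2.1 (fun t => functorChainTerm F k t (chainMin σ) a)

/-- The chain complex `C(P; F)`. -/
noncomputable def functorComplex (F : P ⥤ AddCommGrpCat.{v}) :
    ChainComplex AddCommGrpCat.{max u v} ℤ where
  X n := AddCommGrpCat.of (FunctorChains F n)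
  d i j := AddCommGrpCat.ofHom (functorBoundary F i j)
  shape i j hij := by
    rw [functorBoundary_eq_zero F i j hij]
    rfl
  d_comp_d' i j k hij _ := by
    rw [← AddCommGrpCat.ofHom_comp, functorBoundary_comp F i j k hij]
    rfl

/-- The homology group `H_n(P; F)` of the poset `P` with coefficients in the functor `F`,
for `n ∈ ℤ`. -/
noncomputable abbrev functorHomology (F : P ⥤ AddCommGrpCat.{v}) (n : ℤ) :
    AddCommGrpCat.{max u v} :=
  (functorComplex F).homology n

end FunctorCoefficients

section Cellular

variable {P : Type u} [PartialOrder P]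

open scoped Classical in
/-- For `x < y`, the map `a • s ↦ F(x ≤ y)(a) • (s - {y})` if `y ∈ s`, and `a • s ↦ 0` if `y ∉ s`,
from chains of `F̂_x = {z | x < z}` with coefficients in `F(x)` to chains of `F̂_y` with coefficients
in `F(y)`, from degree `i` to degree `j = i - 1`. It is used when `y` covers `x`, where `s - {y}` is
indeed a chain of `F̂_y` for every chain `s` of `F̂_x` that contains `y`. If `x < y` does not hold,
then it is the zero map (no chain of `F̂_x` contains `y`). -/
noncomputable def deleteMap (F : P ⥤ AddCommGrpCat.{v}) (x y : P) (i j : ℤ) :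
    (Chains (Set.Ioi x) i →₀ F.obj x) →+ (Chains (Set.Ioi y) j →₀ F.obj y) :=
  if h : x < y then
    Finsupp.liftAddHom fun s =>
      if y ∈ s.1 then
        (chainTerm (Set.Ioi y) (F.obj y) j (s.1.erase y)).comp (F.map (homOfLE h.le)).hom
      else 0
  else 0

open scoped Classical in
lemma deleteMap_chainTerm (F : P ⥤ AddCommGrpCat.{v}) (x y : P) (hxy : x < y) (i j : ℤ)
    (s : Finset P) (hs : IsChainOf (Set.Ioi x) i s) (a : F.obj x) :
    deleteMap F x y i j (chainTerm (Set.Ioi x) (F.obj x) i s a) =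
      if y ∈ s then
        chainTerm (Set.Ioi y) (F.obj y) j (s.erase y) ((F.map (homOfLE hxy.le)).hom a)
      else 0 := by
  rw [chainTerm, dif_pos hs, deleteMap, dif_pos hxy]
  simp only [Finsupp.singleAddHom_apply, Finsupp.liftAddHom_apply_single]
  split_ifs <;> rfl

open scoped Classical in
lemma IsChainOf.erase_of_covBy {x y : P} (hxy : x ⋖ y) {i j : ℤ} {s : Finset P}
    (hs : IsChainOf (Set.Ioi x) i s) (hij : j + 1 = i) (hy : y ∈ s) :
    IsChainOf (Set.Ioi y) j (s.erase y) := by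
  refine ⟨?_, (hs.erase hij hy).2⟩
  intro z hz
  have hz' := Finset.mem_erase.1 (Finset.mem_coe.1 hz)
  rcases hs.2.1.total (Finset.mem_coe.2 hy) (Finset.mem_coe.2 hz'.2) with h | h
  · exact lt_of_le_of_ne h hz'.1.symm
  · exact absurd (lt_of_le_of_ne h hz'.1) (hxy.2 (hs.1 hz'.2))

lemma chainTerm_self {X : Type u} [PartialOrder X] (A : Set X) (G : Type v) [AddCommGroup G]
    (n : ℤ) (s : Chains A n) (a : G) : chainTerm A G n s.1 a = Finsupp.single s a := by
  rw [chainTerm, dif_pos s.2]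
  rfl

/-- Deletion of `y` anticommutes with the boundary. -/
lemma reducedBoundary_deleteMap (F : P ⥤ AddCommGrpCat.{v}) (x y : P) (hxy : x < y → x ⋖ y)
    (i j i' j' : ℤ) (hij : j + 1 = i) (hi : i' + 1 = i) :
    (reducedBoundary (Set.Ioi y) (F.obj y) i' j').comp (deleteMap F x y i i') =
      -(deleteMap F x y j j').comp (reducedBoundary (Set.Ioi x) (F.obj x) i j) := by
  classical
  by_cases hlt : x < y
  swap
  · simp [deleteMap, hlt]
  refine Finsupp.addHom_ext fun s a => ?_
  rw [← chainTerm_self, AddMonoidHom.comp_apply, AddMonoidHom.neg_apply, AddMonoidHom.comp_apply,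
    deleteMap_chainTerm F x y hlt i i' _ s.2, reducedBoundary_chainTerm _ _ _ _ _ s.2, map_sum]
  have h1 : ∀ w ∈ s.1, deleteMap F x y j j' (faceSign s.1 w •
      chainTerm (Set.Ioi x) (F.obj x) j (s.1.erase w) a) = faceSign s.1 w •
        if y ∈ s.1.erase w then chainTerm (Set.Ioi y) (F.obj y) j' ((s.1.erase w).erase y)
          ((F.map (homOfLE hlt.le)).hom a) else 0 := by
    intro w hw
    rw [map_zsmul, deleteMap_chainTerm F x y hlt j j' _ (s.2.erase hij hw)]
  rw [Finset.sum_congr rfl h1]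
  by_cases hy : y ∈ s.1
  · have h2 := s.2.erase_of_covBy (hxy hlt) hi hy
    rw [if_pos hy, reducedBoundary_chainTerm _ _ _ _ _ h2, ← Finset.add_sum_erase _ _ hy]
    simp only [Finset.mem_erase, ne_eq, not_true_eq_false, false_and, if_false, smul_zero, zero_add]
    rw [← Finset.sum_neg_distrib]
    refine Finset.sum_congr rfl fun w hw => ?_
    have hw' := Finset.mem_erase.1 hw
    rw [if_pos ⟨Ne.symm hw'.1, hy⟩, Finset.erase_right_comm, ← neg_smul]
    congr 1
    have h3 : y < w := h2.1 hw
    have h4 := faceSign_mul_faceSign s.1 s.2.2.1 w y hw'.2 hy hw'.1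
    have h5 : ∀ t : Finset P, t ⊆ s.1 → faceSign t y = 1 := by
      intro t ht
      have : t.filter (fun z => z < y) = ∅ := by
        refine Finset.filter_eq_empty_iff.2 fun z hz hzy => ?_
        exact (hxy hlt).2 (s.2.1 (ht hz)) hzy
      simp [faceSign, this]
    rw [h5 _ (Finset.erase_subset _ _), h5 _ subset_rfl, mul_one, one_mul] at h4
    rw [h4, neg_neg]
  · rw [if_neg hy, map_zero, eq_comm, neg_eq_zero]
    refine Finset.sum_eq_zero fun w _ => ?_
    rw [if_neg (fun h => hy (Finset.mem_of_mem_erase h)), smul_zero]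

/-- `D_n = {x | ρ x = n}`, for `n ∈ ℤ`. -/
abbrev Level (ρ : Pᵒᵈ →o ℕ) (n : ℤ) : Type u := {x : P // (ρ (OrderDual.toDual x) : ℤ) = n}

variable {ρ : Pᵒᵈ →o ℕ}

lemma IsQuasicellularMorphism.covBy (hρ : IsQuasicellularMorphism ρ) {i j : ℤ} (hij : j + 1 = i)
    (x : Level ρ i) (y : Level ρ j) (hxy : x.1 < y.1) : x.1 ⋖ y.1 := by
  refine ⟨hxy, fun w h1 h2 => ?_⟩
  have h3 := hρ.lt (OrderDual.toDual_lt_toDual.2 h1)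
  have h4 := hρ.lt (OrderDual.toDual_lt_toDual.2 h2)
  have h5 := x.2
  have h6 := y.2
  omega

/-- Deletion of `y ∈ D_{i-1}` as a morphism from the part `C_i → C_{i-1} → C_{i-2}` of the augmented
complex of `F̂_x`, `x ∈ D_i`, to the part `C_{i-1} → C_{i-2} → C_{i-3}` of that of `F̂_y`. The outer
maps carry a sign since deletion of `y` anticommutes with the boundary. -/
noncomputable def deleteHom (hρ : IsQuasicellularMorphism ρ) (F : P ⥤ AddCommGrpCat.{v}) {i j : ℤ}
    (hij : j + 1 = i) (x : Level ρ i) (y : Level ρ j) :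
    (reducedComplex (Set.Ioi x.1) (F.obj x.1)).sc (i - 1) ⟶
      (reducedComplex (Set.Ioi y.1) (F.obj y.1)).sc (j - 1) where
  τ₁ := AddCommGrpCat.ofHom (-deleteMap F x.1 y.1 _ _)
  τ₂ := AddCommGrpCat.ofHom (deleteMap F x.1 y.1 (i - 1) (j - 1))
  τ₃ := AddCommGrpCat.ofHom (-deleteMap F x.1 y.1 _ _)
  comm₁₂ := by
    have h := reducedBoundary_deleteMap F x.1 y.1 (hρ.covBy hij x y)
      ((ComplexShape.down ℤ).prev (i - 1)) (i - 1) ((ComplexShape.down ℤ).prev (j - 1)) (j - 1)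
      (by simp) (by simp; omega)
    have h' : (reducedBoundary (Set.Ioi y.1) (F.obj y.1) ((ComplexShape.down ℤ).prev (j - 1))
        (j - 1)).comp (-deleteMap F x.1 y.1 _ _) = (deleteMap F x.1 y.1 (i - 1) (j - 1)).comp
          (reducedBoundary (Set.Ioi x.1) (F.obj x.1) ((ComplexShape.down ℤ).prev (i - 1))
            (i - 1)) := by
      rw [AddMonoidHom.comp_neg, h, neg_neg]
    exact congrArg AddCommGrpCat.ofHom h'
  comm₂₃ := by
    have hi : (ComplexShape.down ℤ).next (i - 1) = i - 1 - 1 :=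
      (ComplexShape.down ℤ).next_eq' (by simp)
    have hj : (ComplexShape.down ℤ).next (j - 1) = j - 1 - 1 :=
      (ComplexShape.down ℤ).next_eq' (by simp)
    have h := reducedBoundary_deleteMap F x.1 y.1 (hρ.covBy hij x y)
      (i - 1) ((ComplexShape.down ℤ).next (i - 1)) (j - 1) ((ComplexShape.down ℤ).next (j - 1))
      (by omega) (by omega)
    have h' : (reducedBoundary (Set.Ioi y.1) (F.obj y.1) (j - 1)
        ((ComplexShape.down ℤ).next (j - 1))).comp (deleteMap F x.1 y.1 (i - 1) (j - 1)) =
          (-deleteMap F x.1 y.1 _ _).comp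
            (reducedBoundary (Set.Ioi x.1) (F.obj x.1) (i - 1)
              ((ComplexShape.down ℤ).next (i - 1))) := by
      rw [AddMonoidHom.neg_comp, h]
    exact congrArg AddCommGrpCat.ofHom h'

/-- The map `H̃_{i-1}(F̂_x; F(x)) → H̃_{j-1}(F̂_y; F(y))`, `j = i - 1`, given on classes of cycles by
`[∑ₖ aₖ • sₖ] ↦ [∑_{sₖ ∋ y} F(x ≤ y)(aₖ) • (sₖ - {y})]`, where `x ∈ D_i` and `y ∈ D_j`. -/
noncomputable def cellularEntry (hρ : IsQuasicellularMorphism ρ) (F : P ⥤ AddCommGrpCat.{v})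
    {i j : ℤ} (hij : j + 1 = i) (x : Level ρ i) (y : Level ρ j) :
    reducedHomology (Set.Ioi x.1) (F.obj x.1) (i - 1) ⟶
      reducedHomology (Set.Ioi y.1) (F.obj y.1) (j - 1) :=
  ShortComplex.homologyMap (deleteHom hρ F hij x y)

/-- The group `⨁_{x ∈ D_n} H̃_{n-1}(F̂_x; F(x))`. -/
abbrev CellularChains (ρ : Pᵒᵈ →o ℕ) (F : P ⥤ AddCommGrpCat.{v}) (n : ℤ) : Type (max u v) :=
  DirectSum (Level ρ n) fun x => reducedHomology (Set.Ioi x.1) (F.obj x.1) (n - 1)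

lemma IsQuasicellularMorphism.finite_above (hρ : IsQuasicellularMorphism ρ) (x : P) (j : ℤ) :
    {y : Level ρ j | x < y.1}.Finite := by
  have h := hρ.locallyFinite (OrderDual.toDual x)
  refine Set.Finite.of_finite_image (f := fun y : Level ρ j => OrderDual.toDual y.1)
    (h.subset ?_) ?_
  · rintro _ ⟨y, hy, rfl⟩
    exact OrderDual.toDual_le_toDual.2 (le_of_lt hy)
  · intro a _ b _ hab
    exact Subtype.ext hab

open scoped Classical in
/-- The differential of the cellular complex: the component in `y ∈ D_j` of the image of a family
`(c_x)` is `∑_x cellularEntry x y (c_x)`. Here `cellularEntry x y = 0` unless `x < y`, and there are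
only finitely many `y > x`. -/
noncomputable def cellularBoundary (hρ : IsQuasicellularMorphism ρ) (F : P ⥤ AddCommGrpCat.{v})
    {i j : ℤ} (hij : j + 1 = i) : CellularChains ρ F i →+ CellularChains ρ F j :=
  DirectSum.toAddMonoid fun x =>
    ∑ y ∈ (hρ.finite_above x.1 j).toFinset,
      (DirectSum.of (fun y : Level ρ j => reducedHomology (Set.Ioi y.1) (F.obj y.1) (j - 1)) y).comp
        (cellularEntry hρ F hij x y).hom

lemma IsQuasicellularMorphism.injOn (hρ : IsQuasicellularMorphism ρ) {s : Finset P}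
    (hs : IsChain (· ≤ ·) (s : Set P)) :
    Set.InjOn (fun w => ρ (OrderDual.toDual w)) (s : Set P) := by
  intro a ha b hb hab
  by_contra hne
  have hab' : ρ (OrderDual.toDual a) = ρ (OrderDual.toDual b) := hab
  rcases hs.total ha hb with h | h
  · have := hρ.lt (OrderDual.toDual_lt_toDual.2 (lt_of_le_of_ne h hne))
    omega
  · have := hρ.lt (OrderDual.toDual_lt_toDual.2 (lt_of_le_of_ne h (Ne.symm hne)))
    omega

lemma IsQuasicellularMorphism.exists_level (hρ : IsQuasicellularMorphism ρ) {i j : ℤ}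
    (hij : j + 1 = i) (x : Level ρ i) {s : Finset P} (hs : IsChainOf (Set.Ioi x.1) (i - 1) s)
    (hne : s.Nonempty) : ∃ m ∈ s, (ρ (OrderDual.toDual m) : ℤ) = j := by
  have h1 : ∀ w ∈ s, ρ (OrderDual.toDual w) < ρ (OrderDual.toDual x.1) := fun w hw =>
    hρ.lt (OrderDual.toDual_lt_toDual.2 (hs.1 hw))
  have h2 := hs.2.2
  have h3 := x.2
  have h4 : s.image (fun w => ρ (OrderDual.toDual w)) =
      Finset.range (ρ (OrderDual.toDual x.1)) := by
    refine Finset.eq_of_subset_of_card_le ?_ ?_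
    · intro n hn
      obtain ⟨w, hw, rfl⟩ := Finset.mem_image.1 hn
      exact Finset.mem_range.2 (h1 w hw)
    · rw [Finset.card_image_of_injOn (hρ.injOn hs.2.1), Finset.card_range]
      omega
  have h5 := Finset.card_pos.2 hne
  have h6 : j.toNat ∈ s.image (fun w => ρ (OrderDual.toDual w)) := by
    rw [h4, Finset.mem_range]
    omega
  obtain ⟨m, hm, hmj⟩ := Finset.mem_image.1 h6
  refine ⟨m, hm, ?_⟩
  omega

/-- On the chain level, deleting first some `y ∈ D_j` and then `y' ∈ D_k` is, summed over all `y`,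
deleting `y'` from the boundary. -/
lemma sum_deleteMap_deleteMap (hρ : IsQuasicellularMorphism ρ) (F : P ⥤ AddCommGrpCat.{v})
    {i j k : ℤ} (hij : j + 1 = i) (hjk : k + 1 = j) (x : Level ρ i) (y' : Level ρ k)
    (z : Chains (Set.Ioi x.1) (i - 1) →₀ F.obj x.1) :
    ∑ y ∈ (hρ.finite_above x.1 j).toFinset, deleteMap F y.1 y'.1 (j - 1) (k - 1)
        (deleteMap F x.1 y.1 (i - 1) (j - 1) z) =
      deleteMap F x.1 y'.1 (j - 1) (k - 1)
        (reducedBoundary (Set.Ioi x.1) (F.obj x.1) (i - 1) (j - 1) z) := by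
  classical
  by_cases hlt : x.1 < y'.1
  swap
  · rw [deleteMap, dif_neg hlt, AddMonoidHom.zero_apply]
    refine Finset.sum_eq_zero fun y hy => ?_
    have hxy : x.1 < y.1 := by simpa using hy
    rw [deleteMap, dif_neg (fun h => hlt (hxy.trans h)), AddMonoidHom.zero_apply]
  induction z using Finsupp.induction_linear with
  | zero => simp
  | add f g hf hg => simp only [map_add, Finset.sum_add_distrib, hf, hg]
  | single s a =>
    rw [← chainTerm_self, reducedBoundary_chainTerm _ _ _ _ _ s.2, map_sum]
    have h1 : ∀ w ∈ s.1, deleteMap F x.1 y'.1 (j - 1) (k - 1) (faceSign s.1 w •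
        chainTerm (Set.Ioi x.1) (F.obj x.1) (j - 1) (s.1.erase w) a) = faceSign s.1 w •
          if y'.1 ∈ s.1.erase w then
            chainTerm (Set.Ioi y'.1) (F.obj y'.1) (k - 1) ((s.1.erase w).erase y'.1)
              ((F.map (homOfLE hlt.le)).hom a) else 0 := by
      intro w hw
      rw [map_zsmul, deleteMap_chainTerm F x.1 y'.1 hlt _ _ _ (s.2.erase (by omega) hw)]
    rw [Finset.sum_congr rfl h1]
    have h2 : ∀ y ∈ (hρ.finite_above x.1 j).toFinset, deleteMap F y.1 y'.1 (j - 1) (k - 1)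
        (deleteMap F x.1 y.1 (i - 1) (j - 1)
          (chainTerm (Set.Ioi x.1) (F.obj x.1) (i - 1) s.1 a)) =
        if y.1 ∈ s.1 ∧ y'.1 ∈ s.1 then
          chainTerm (Set.Ioi y'.1) (F.obj y'.1) (k - 1) ((s.1.erase y.1).erase y'.1)
            ((F.map (homOfLE hlt.le)).hom a) else 0 := by
      intro y hy
      have hxy : x.1 < y.1 := by simpa using hy
      rw [deleteMap_chainTerm F x.1 y.1 hxy _ _ _ s.2]
      by_cases hys : y.1 ∈ s.1
      swap
      · rw [if_neg hys, if_neg (fun h => hys h.1), map_zero]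
      have h3 := s.2.erase_of_covBy (hρ.covBy hij x y hxy) (j := j - 1) (by omega) hys
      rw [if_pos hys]
      by_cases hyy' : y.1 < y'.1
      · rw [deleteMap_chainTerm F y.1 y'.1 hyy' _ _ _ h3]
        by_cases hys' : y'.1 ∈ s.1
        · rw [if_pos (Finset.mem_erase.2 ⟨hyy'.ne', hys'⟩), if_pos ⟨hys, hys'⟩]
          congr 1
          rw [← AddCommGrpCat.comp_apply, ← F.map_comp]
          rfl
        · rw [if_neg (fun h => hys' (Finset.mem_of_mem_erase h)), if_neg (fun h => hys' h.2)]
      · rw [deleteMap, dif_neg hyy', if_neg, AddMonoidHom.zero_apply]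
        rintro ⟨_, hys'⟩
        refine hyy' (h3.1 (Finset.mem_coe.2 (Finset.mem_erase.2 ⟨?_, hys'⟩)))
        intro he
        have e1 := y.2
        have e2 := y'.2
        rw [he] at e2
        omega
    rw [Finset.sum_congr rfl h2]
    by_cases hys' : y'.1 ∈ s.1
    swap
    · rw [Finset.sum_eq_zero, Finset.sum_eq_zero]
      · intro w _
        rw [if_neg (fun h => hys' (Finset.mem_of_mem_erase h)), smul_zero]
      · intro y _
        rw [if_neg (fun h => hys' h.2)]
    obtain ⟨m, hm, hmj⟩ := hρ.exists_level hij x s.2 ⟨_, hys'⟩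
    have hmy' : m ≠ y'.1 := by
      intro he
      have e2 := y'.2
      rw [← he] at e2
      omega
    have hxm : x.1 < m := s.2.1 hm
    have hcov := hρ.covBy hij x ⟨m, hmj⟩ hxm
    have hmin : m < y'.1 := (s.2.erase_of_covBy hcov (j := j - 1) (by omega) hm).1
      (Finset.mem_coe.2 (Finset.mem_erase.2 ⟨hmy'.symm, hys'⟩))
    rw [Finset.sum_eq_single (⟨m, hmj⟩ : Level ρ j), Finset.sum_eq_single m]
    · rw [if_pos ⟨hm, hys'⟩, if_pos (Finset.mem_erase.2 ⟨hmy'.symm, hys'⟩)]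
      have : s.1.filter (fun w => w < m) = ∅ := by
        refine Finset.filter_eq_empty_iff.2 fun w hw hwm => ?_
        exact hcov.2 (s.2.1 hw) hwm
      simp [faceSign, this]
    · intro w hw hwm
      split_ifs
      · rw [chainTerm, dif_neg, AddMonoidHom.zero_apply, smul_zero]
        intro h
        have : y'.1 < m := h.1 (Finset.mem_coe.2
          (Finset.mem_erase.2 ⟨hmy', Finset.mem_erase.2 ⟨Ne.symm hwm, hm⟩⟩))
        exact lt_asymm this hmin
      · rw [smul_zero]
    · intro h
      exact absurd hm h
    · intro y _ hym
      rw [if_neg]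
      rintro ⟨hys, _⟩
      refine hym (Subtype.ext (hρ.injOn s.2.2.1 hys hm ?_))
      have := y.2
      change ρ (OrderDual.toDual y.1) = ρ (OrderDual.toDual m)
      omega
    · intro h
      exact absurd (by simpa using hxm) h

lemma cellularEntry_eq_zero (hρ : IsQuasicellularMorphism ρ) (F : P ⥤ AddCommGrpCat.{v})
    {i j : ℤ} (hij : j + 1 = i) (x : Level ρ i) (y : Level ρ j) (hxy : ¬ x.1 < y.1) :
    cellularEntry hρ F hij x y = 0 := by
  have h : deleteHom hρ F hij x y = 0 := by
    ext1
    all_goals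
      simp only [deleteHom, deleteMap, dif_neg hxy, neg_zero]
      rfl
  rw [cellularEntry, h, ShortComplex.homologyMap_zero]
  rfl

open scoped Classical in
lemma cellularBoundary_of (hρ : IsQuasicellularMorphism ρ) (F : P ⥤ AddCommGrpCat.{v})
    {i j : ℤ} (hij : j + 1 = i) (x : Level ρ i)
    (c : reducedHomology (Set.Ioi x.1) (F.obj x.1) (i - 1)) (y : Level ρ j) :
    cellularBoundary hρ F hij
        (DirectSum.of (fun x : Level ρ i => reducedHomology (Set.Ioi x.1) (F.obj x.1) (i - 1)) x c)
        y = (cellularEntry hρ F hij x y).hom c := by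
  classical
  rw [cellularBoundary, DirectSum.toAddMonoid_of]
  simp only [AddMonoidHom.finsetSum_apply, AddMonoidHom.comp_apply]
  rw [DFinsupp.finsetSum_apply]
  by_cases hxy : x.1 < y.1
  · rw [Finset.sum_eq_single y]
    · exact DirectSum.of_eq_same _ _
    · intro y' _ hne
      exact DirectSum.of_eq_of_ne _ _ _ hne.symm
    · intro h
      exact absurd (by simpa using hxy) h
  · rw [cellularEntry_eq_zero hρ F hij x y hxy]
    refine Finset.sum_eq_zero fun y' hy' => ?_
    refine DirectSum.of_eq_of_ne _ _ _ ?_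
    rintro rfl
    exact hxy (by simpa using hy')

lemma exists_cycle (K : ChainComplex AddCommGrpCat.{v} ℤ) (n : ℤ) (c : K.homology n) :
    ∃ z : (K.sc n).cycles, (K.sc n).homologyπ.hom z = c :=
  (AddCommGrpCat.epi_iff_surjective (K.sc n).homologyπ).1 inferInstance c

/-- The part `C_{n+1} → C_n → C_{n-1}` of the augmented complex of `F̂_x`. -/
noncomputable abbrev augPart (F : P ⥤ AddCommGrpCat.{v}) (x : P) (n : ℤ) :
    ShortComplex AddCommGrpCat.{max u v} :=
  (reducedComplex (Set.Ioi x) (F.obj x)).sc n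

lemma cellularEntry_homologyπ (hρ : IsQuasicellularMorphism ρ) (F : P ⥤ AddCommGrpCat.{v})
    {i j : ℤ} (hij : j + 1 = i) (x : Level ρ i) (y : Level ρ j)
    (z : (augPart F x.1 (i - 1)).cycles) :
    (cellularEntry hρ F hij x y).hom ((augPart F x.1 (i - 1)).homologyπ.hom z) =
      (augPart F y.1 (j - 1)).homologyπ.hom
        ((ShortComplex.cyclesMap (deleteHom hρ F hij x y)).hom z) := by
  have h := ShortComplex.homologyπ_naturality (deleteHom hρ F hij x y)
  exact congrArg (fun f => f.hom z) h

lemma iCycles_cyclesMap (hρ : IsQuasicellularMorphism ρ) (F : P ⥤ AddCommGrpCat.{v})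
    {i j : ℤ} (hij : j + 1 = i) (x : Level ρ i) (y : Level ρ j)
    (z : (augPart F x.1 (i - 1)).cycles) :
    (augPart F y.1 (j - 1)).iCycles.hom
        ((ShortComplex.cyclesMap (deleteHom hρ F hij x y)).hom z) =
      deleteMap F x.1 y.1 (i - 1) (j - 1) ((augPart F x.1 (i - 1)).iCycles.hom z) :=
  congrArg (fun f => f.hom z) (ShortComplex.cyclesMap_i (deleteHom hρ F hij x y))

lemma reducedBoundary_iCycles (F : P ⥤ AddCommGrpCat.{v}) (x : P) (i j : ℤ) (hij : j + 1 = i)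
    (z : (augPart F x i).cycles) :
    reducedBoundary (Set.Ioi x) (F.obj x) i j ((augPart F x i).iCycles.hom z) = 0 := by
  obtain rfl : (ComplexShape.down ℤ).next i = j := (ComplexShape.down ℤ).next_eq' hij
  exact congrArg (fun f => f.hom z) (augPart F x i).iCycles_g

lemma sum_cellularEntry_cellularEntry (hρ : IsQuasicellularMorphism ρ)
    (F : P ⥤ AddCommGrpCat.{v}) {i j k : ℤ} (hij : j + 1 = i) (hjk : k + 1 = j) (x : Level ρ i)
    (y' : Level ρ k) (c : reducedHomology (Set.Ioi x.1) (F.obj x.1) (i - 1)) :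
    ∑ y ∈ (hρ.finite_above x.1 j).toFinset,
      (cellularEntry hρ F hjk y y').hom ((cellularEntry hρ F hij x y).hom c) = 0 := by
  obtain ⟨z, rfl⟩ := exists_cycle _ _ c
  have h1 : ∀ y ∈ (hρ.finite_above x.1 j).toFinset,
      (cellularEntry hρ F hjk y y').hom ((cellularEntry hρ F hij x y).hom
        ((augPart F x.1 (i - 1)).homologyπ.hom z)) =
      (augPart F y'.1 (k - 1)).homologyπ.hom
        ((ShortComplex.cyclesMap (deleteHom hρ F hjk y y')).hom
          ((ShortComplex.cyclesMap (deleteHom hρ F hij x y)).hom z)) := by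
    intro y _
    rw [cellularEntry_homologyπ, cellularEntry_homologyπ]
  refine (Finset.sum_congr rfl h1).trans ?_
  refine (map_sum (augPart F y'.1 (k - 1)).homologyπ.hom _ _).symm.trans ?_
  have h2 : ∑ y ∈ (hρ.finite_above x.1 j).toFinset,
      (ShortComplex.cyclesMap (deleteHom hρ F hjk y y')).hom
          ((ShortComplex.cyclesMap (deleteHom hρ F hij x y)).hom z) = 0 := by
    apply (AddCommGrpCat.mono_iff_injective (augPart F y'.1 (k - 1)).iCycles).1 inferInstance
    refine (map_sum (augPart F y'.1 (k - 1)).iCycles.hom _ _).trans ?_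
    refine Eq.trans ?_ (map_zero (augPart F y'.1 (k - 1)).iCycles.hom).symm
    refine (Finset.sum_congr rfl fun y _ => ?_).trans
      ((sum_deleteMap_deleteMap hρ F hij hjk x y'
        ((augPart F x.1 (i - 1)).iCycles.hom z)).trans ?_)
    · rw [iCycles_cyclesMap, iCycles_cyclesMap]
    · rw [reducedBoundary_iCycles F x.1 (i - 1) (j - 1) (by omega)]
      exact map_zero _
  rw [h2]
  exact map_zero _

lemma cellularBoundary_comp (hρ : IsQuasicellularMorphism ρ) (F : P ⥤ AddCommGrpCat.{v})
    {i j k : ℤ} (hij : j + 1 = i) (hjk : k + 1 = j) :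
    (cellularBoundary hρ F hjk).comp (cellularBoundary hρ F hij) = 0 := by
  classical
  refine DirectSum.addHom_ext fun x c => ?_
  refine DFinsupp.ext fun y' => ?_
  have h0 : cellularBoundary hρ F hij
      (DirectSum.of (fun x : Level ρ i => reducedHomology (Set.Ioi x.1) (F.obj x.1) (i - 1)) x c) =
      ∑ y ∈ (hρ.finite_above x.1 j).toFinset, DirectSum.of
        (fun y : Level ρ j => reducedHomology (Set.Ioi y.1) (F.obj y.1) (j - 1)) y
          ((cellularEntry hρ F hij x y).hom c) := by
    rw [cellularBoundary, DirectSum.toAddMonoid_of]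
    simp only [AddMonoidHom.finsetSum_apply, AddMonoidHom.comp_apply]
  rw [AddMonoidHom.comp_apply, h0, map_sum, DFinsupp.finsetSum_apply]
  simp only [cellularBoundary_of]
  exact sum_cellularEntry_cellularEntry hρ F hij hjk x y' c

/-- The cellular complex of `P` with coefficients in `F`. Its `n`-th group is
`⨁_{x ∈ D_n} H̃_{n-1}(F̂_x; F(x))`, and its differential sends the family of classes
`[∑ₖ aˣₖ • sˣₖ]`, `x ∈ D_n`, to the family whose component in `y ∈ D_{n-1}` is the class of
`∑_x ∑_{sˣₖ ∋ y} F(x ≤ y)(aˣₖ) • (sˣₖ - {y})`. -/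
noncomputable def cellularComplex (hρ : IsQuasicellularMorphism ρ) (F : P ⥤ AddCommGrpCat.{v}) :
    ChainComplex AddCommGrpCat.{max u v} ℤ where
  X n := AddCommGrpCat.of (CellularChains ρ F n)
  d i j := if h : j + 1 = i then AddCommGrpCat.ofHom (cellularBoundary hρ F h) else 0
  shape i j hij := dif_neg hij
  d_comp_d' i j k hij hjk := by
    have hij' : j + 1 = i := hij
    have hjk' : k + 1 = j := hjk
    rw [dif_pos hij', dif_pos hjk', ← AddCommGrpCat.ofHom_comp, cellularBoundary_comp hρ F hij' hjk']
    rfl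

end Cellular

end PosetHomology

/-! Filter C(P; F) by the rank of the minimum: let Φ_p be spanned by the simplices σ with ρ(min σ) ≤
p. Deleting the minimum strictly lowers this rank and deleting any other vertex keeps it. Hence
Φ_p/Φ_{p-1} is, up to sign and a shift by one, the direct sum over x ∈ D_p of the augmented
complexes of F̂_x with coefficients in F(x); the identification is by cones with apex x (`coneSum`).
Quasicellularity and a universal coefficient argument (`IsQuasicellularMorphism.reducedExact`) show
that its homology is concentrated in degree p. So the spectral sequence of the filtration has a
single row, namely the cellular complex.

The spectral sequence is replaced by an explicit quasi-isomorphism `cellularToFunctor`. Ranks are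
distinct along a chain, so a chain of F̂_x has at most ρ(x) elements. Therefore H̃_{n-1}(F̂_x; F(x))
with ρ(x) = n is a group of cycles, and a class can be sent to the cone over its unique cycle. The
same count shows that Φ_{n-1} contains no nonzero n-chain, so the image consists exactly of the
n-chains c ∈ Φ_n with dc ∈ Φ_{n-1} (`exists_cellularToFunctor_eq`).

An n-chain whose boundary lies in Φ_n can be moved into Φ_n by subtracting a boundary, because the
quotients Φ_p/Φ_{p-1} with p > n have no homology in degree n
(`exists_sub_functorBoundary_mem_degree`). Applied to n-cycles this gives surjectivity on homology;
applied to (n+1)-chains that bound a cellular cycle it gives injectivity. -/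

namespace PosetHomology

/-! ### Splitting exact sequences of finite free modules. -/

section Splitting

/-- A two-sided splitting of an exact sequence of finite free modules over a principal ideal domain. -/
lemma exists_splitting_of_exact {R A B C D : Type*} [CommRing R] [IsDomain R]
    [IsPrincipalIdealRing R] [AddCommGroup A] [AddCommGroup B] [AddCommGroup C] [AddCommGroup D]
    [Module R A] [Module R B] [Module R C] [Module R D] [Module.Free R B] [Module.Free R C]
    [Module.Free R D] [Module.Finite R B] [Module.Finite R C] [Module.Finite R D]
    (f : A →ₗ[R] B) (g : B →ₗ[R] C) (h : C →ₗ[R] D)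
    (hfg : ∀ b, g b = 0 → ∃ a, f a = b) (hgh : ∀ c, h c = 0 → ∃ b, g b = c)
    (hhg : ∀ b, h (g b) = 0) :
    ∃ (s : B →ₗ[R] A) (t : C →ₗ[R] B), ∀ b, f (s b) + t (g b) = b := by
  -- The images are submodules of finite free modules over a PID, hence free, so each map splits
  -- over its image.
  obtain ⟨σf, hσf⟩ := f.rangeRestrict.exists_rightInverse_of_surjective f.range_rangeRestrict
  obtain ⟨σg, hσg⟩ := g.rangeRestrict.exists_rightInverse_of_surjective g.range_rangeRestrict
  obtain ⟨σh, hσh⟩ := h.rangeRestrict.exists_rightInverse_of_surjective h.range_rangeRestrict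
  have ef : ∀ y, f (σf y) = y := fun y => congrArg Subtype.val (LinearMap.congr_fun hσf y)
  have eg : ∀ y, g (σg y) = y := fun y => congrArg Subtype.val (LinearMap.congr_fun hσg y)
  have eh : ∀ y, h (σh y) = y := fun y => congrArg Subtype.val (LinearMap.congr_fun hσh y)
  -- Subtracting the split part `σh (h c)` projects `C` onto `ker h`, which is the range of `g`;
  -- `πB` is the analogous projection onto the range of `f`.
  let πC : C →ₗ[R] LinearMap.range g :=
    LinearMap.codRestrict _ (LinearMap.id - σh ∘ₗ h.rangeRestrict)
      fun c => hgh _ (by simp [eh])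
  let πB : B →ₗ[R] LinearMap.range f :=
    LinearMap.codRestrict _ (LinearMap.id - σg ∘ₗ g.rangeRestrict)
      fun b => hfg _ (by simp [eg])
  refine ⟨σf ∘ₗ πB, σg ∘ₗ πC, fun b => ?_⟩
  have h1 : πC (g b) = g.rangeRestrict b := by
    refine Subtype.ext ?_
    have : h.rangeRestrict (g b) = 0 := Subtype.ext (hhg b)
    change g b - σh (h.rangeRestrict (g b)) = g b
    rw [this, map_zero, sub_zero]
  simp only [LinearMap.comp_apply, ef, h1]
  exact sub_add_cancel b (σg (g.rangeRestrict b))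

end Splitting

/-! ### Change of coefficients for free abelian groups. -/

section Coefficients

variable {S T : Type*} {G : Type*} [AddCommGroup G]

/-- The map `n ↦ n • g` applied to the coefficients of a chain. -/
noncomputable def coefficientMap (S : Type*) (g : G) : (S →₀ ℤ) →+ (S →₀ G) :=
  Finsupp.mapRange.addMonoidHom (zmultiplesHom G g)

@[simp]
lemma coefficientMap_single (g : G) (s : S) (n : ℤ) :
    coefficientMap S g (Finsupp.single s n) = Finsupp.single s (n • g) := by
  simp [coefficientMap]

/-- The extension of a map of free abelian groups to coefficients in `G`. -/
noncomputable def extendCoefficients (G : Type*) [AddCommGroup G]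
    (f : (S →₀ ℤ) →+ (T →₀ ℤ)) : (S →₀ G) →+ (T →₀ G) :=
  Finsupp.liftAddHom fun s =>
    { toFun := fun g => coefficientMap T g (f (Finsupp.single s 1))
      map_zero' := by
        ext t
        simp [coefficientMap]
      map_add' := fun a b => by
        ext t
        simp [coefficientMap] }

/-- This is (f ⊗ G)(z ⊗ g) = f(z) ⊗ g, with `coefficientMap` playing the role of z ↦ z ⊗ g; tensor
products are thereby avoided. -/
lemma extendCoefficients_coefficientMap (f : (S →₀ ℤ) →+ (T →₀ ℤ)) (g : G) (z : S →₀ ℤ) :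
    extendCoefficients G f (coefficientMap S g z) = coefficientMap T g (f z) := by
  induction z using Finsupp.induction_linear with
  | zero => simp
  | add z w hz hw => simp only [map_add, hz, hw]
  | single s n =>
    have h : Finsupp.single s n = n • Finsupp.single s (1 : ℤ) := by simp
    rw [h, map_zsmul, map_zsmul, map_zsmul, map_zsmul]
    congr 1
    rw [extendCoefficients, coefficientMap_single, one_smul, Finsupp.liftAddHom_apply_single]
    rfl

end Coefficients

/-! ### Chains of the dual poset. -/

section Dual

variable {X : Type u}

/-- A chain of `X` as a chain of the dual poset. -/
def dualChain (s : Finset X) : Finset Xᵒᵈ := s.map OrderDual.toDual.toEmbedding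

@[simp]
lemma mem_dualChain {s : Finset X} {w : Xᵒᵈ} :
    w ∈ dualChain s ↔ OrderDual.ofDual w ∈ s := by
  simp [dualChain]

lemma dualChain_erase [DecidableEq X] [DecidableEq Xᵒᵈ] (s : Finset X) (w : X) :
    dualChain (s.erase w) = (dualChain s).erase (OrderDual.toDual w) := by
  ext z
  simp only [mem_dualChain, Finset.mem_erase]
  rfl

end Dual

/-! ### Exactness of augmented complexes: universal coefficients and duality. -/

section Exactness

variable {X : Type u} [PartialOrder X]

lemma reducedBoundary_coefficientMap (A : Set X) {G : Type v} [AddCommGroup G] (i j : ℤ) (g : G)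
    (z : Chains A i →₀ ℤ) :
    reducedBoundary A G i j (coefficientMap _ g z) =
      coefficientMap _ g (reducedBoundary A ℤ i j z) := by
  classical
  induction z using Finsupp.induction_linear with
  | zero => simp
  | add z w hz hw => simp only [map_add, hz, hw]
  | single s n =>
    rw [coefficientMap_single, ← chainTerm_self, ← chainTerm_self,
      reducedBoundary_chainTerm _ _ _ _ _ s.2, reducedBoundary_chainTerm _ _ _ _ _ s.2, map_sum]
    refine Finset.sum_congr rfl fun w _ => ?_
    rw [(coefficientMap (Chains A j) g).map_zsmul]
    refine congrArg _ ?_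
    unfold chainTerm
    split_ifs <;> simp

/-- Exactness of the augmented complex of `A` in degree `j`, on elements. -/
def ReducedExact (A : Set X) (G : Type v) [AddCommGroup G] (i j k : ℤ) : Prop :=
  ∀ z : Chains A j →₀ G, reducedBoundary A G j k z = 0 → ∃ w, reducedBoundary A G i j w = z

lemma reducedExact_of_subsingleton (A : Set X) (G : Type v) [AddCommGroup G] {i j k : ℤ}
    (hij : j + 1 = i) (hjk : k + 1 = j) (h : Subsingleton (reducedHomology A G j)) :
    ReducedExact A G i j k := by
  have h1 : (reducedComplex A G).ExactAt j := by
    rw [HomologicalComplex.exactAt_iff_isZero_homology]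
    exact AddCommGrpCat.isZero_of_subsingleton _
  rw [HomologicalComplex.exactAt_iff' _ i j k ((ComplexShape.down ℤ).prev_eq' hij)
    ((ComplexShape.down ℤ).next_eq' hjk), ShortComplex.ab_exact_iff] at h1
  exact h1

lemma finite_chains {A : Set X} (hA : A.Finite) (n : ℤ) : Finite (Chains A n) := by
  refine (hA.toFinset.powerset.finite_toSet.subset fun s hs => ?_).to_subtype
  have h : IsChainOf A n s := hs
  exact Finset.mem_coe.2 (Finset.mem_powerset.2 fun w hw => hA.mem_toFinset.2 (h.1 hw))

/-- Vanishing of integral homology in two consecutive degrees gives vanishing of homology with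
arbitrary coefficients in the upper one. -/
lemma ReducedExact.extend {A : Set X} (hA : A.Finite) {i j k l : ℤ} (hjk : k + 1 = j)
    (h1 : ReducedExact A ℤ i j k) (h2 : ReducedExact A ℤ j k l) (G : Type v) [AddCommGroup G] :
    ReducedExact A G i j k := by
  have := finite_chains hA j
  have := finite_chains hA k
  have := finite_chains hA l
  obtain ⟨s, t, hst⟩ := exists_splitting_of_exact
    (reducedBoundary A ℤ i j).toIntLinearMap (reducedBoundary A ℤ j k).toIntLinearMap
    (reducedBoundary A ℤ k l).toIntLinearMap h1 h2
    (fun b => DFunLike.congr_fun (reducedBoundary_comp A ℤ j k l hjk) b)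
  -- The integral splitting is a partial contracting homotopy. Being an identity between additive
  -- maps, it survives tensoring with `G`, and it need only be checked on elements c ⊗ g.
  have key : ∀ z : Chains A j →₀ G,
      reducedBoundary A G i j (extendCoefficients G s.toAddMonoidHom z) +
        extendCoefficients G t.toAddMonoidHom (reducedBoundary A G j k z) = z := by
    intro z
    induction z using Finsupp.induction_linear with
    | zero => simp
    | add z w hz hw =>
      simp only [map_add]
      nth_rewrite 3 [← hz]
      nth_rewrite 3 [← hw]
      abel
    | single c g =>
      have hc : Finsupp.single c g = coefficientMap _ g (Finsupp.single c 1) := by simp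
      rw [hc, extendCoefficients_coefficientMap, reducedBoundary_coefficientMap,
        reducedBoundary_coefficientMap, extendCoefficients_coefficientMap, ← map_add]
      exact congrArg _ (hst _)
  intro z hz
  refine ⟨extendCoefficients G s.toAddMonoidHom z, ?_⟩
  have := key z
  rwa [hz, map_zero, add_zero] at this

lemma isChainOf_dualChain {A : Set X} {n : ℤ} {s : Finset X} :
    IsChainOf (OrderDual.ofDual ⁻¹' A) n (dualChain s) ↔ IsChainOf A n s := by
  have h : (dualChain s : Set Xᵒᵈ) = OrderDual.ofDual ⁻¹' (s : Set X) := by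
    ext w
    simp
  refine and_congr ?_ (and_congr ?_ ?_)
  · rw [h]
    rfl
  · rw [h]
    exact ⟨fun H a ha b hb hab => (H ha hb hab).symm, fun H a ha b hb hab => (H ha hb hab).symm⟩
  · simp [dualChain]

/-- The `n`-chains of `A` are those of `A` as a subset of the dual poset. -/
def dualChainsEquiv (A : Set X) (n : ℤ) :
    Chains A n ≃ Chains (OrderDual.ofDual ⁻¹' A : Set Xᵒᵈ) n :=
  (OrderDual.toDual : X ≃ Xᵒᵈ).finsetCongr.subtypeEquiv fun _ => isChainOf_dualChain.symm

/-- Reversing the order moves the vertex in position k to position card s - 1 - k, so the sign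
changes by a factor that does not depend on the vertex. -/
lemma faceSign_dualChain {s : Finset X} (hs : IsChain (· ≤ ·) (s : Set X)) {w : X} (hw : w ∈ s) :
    faceSign (dualChain s) (OrderDual.toDual w) = (-1) ^ (s.card + 1) * faceSign s w := by
  classical
  have h1 : ((dualChain s).filter (fun z => z < OrderDual.toDual w)).card =
      (s.filter (fun z => w < z)).card := by
    rw [dualChain, Finset.filter_map, Finset.card_map]
    rfl
  have h2 : s.card = (s.filter (fun z => z < w)).card + (s.filter (fun z => w < z)).card + 1 := by
    rw [← Finset.card_erase_add_one hw, ← Finset.card_union_of_disjoint]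
    · congr 2
      ext z
      simp only [Finset.mem_erase, Finset.mem_union, Finset.mem_filter]
      constructor
      · rintro ⟨hz, hzs⟩
        rcases hs hzs hw hz with h | h
        · exact Or.inl ⟨hzs, lt_of_le_of_ne h hz⟩
        · exact Or.inr ⟨hzs, lt_of_le_of_ne h (Ne.symm hz)⟩
      · rintro (⟨h, h'⟩ | ⟨h, h'⟩)
        · exact ⟨h'.ne, h⟩
        · exact ⟨h'.ne', h⟩
    · rw [Finset.disjoint_filter]
      exact fun z _ h h' => lt_asymm h h'
  unfold faceSign
  rw [h1, h2, ← pow_add]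
  rw [show (s.filter (fun z => z < w)).card + (s.filter (fun z => w < z)).card + 1 + 1 +
    (s.filter (fun z => z < w)).card = (s.filter (fun z => w < z)).card +
      2 * ((s.filter (fun z => z < w)).card + 1) by ring, pow_add, pow_mul]
  simp

lemma mapDomain_chainTerm (A : Set X) (G : Type v) [AddCommGroup G] (n : ℤ) (s : Finset X) (a : G) :
    Finsupp.mapDomain (dualChainsEquiv A n) (chainTerm A G n s a) =
      chainTerm (OrderDual.ofDual ⁻¹' A : Set Xᵒᵈ) G n (dualChain s) a := by
  by_cases hs : IsChainOf A n s
  · rw [chainTerm, chainTerm, dif_pos hs, dif_pos (isChainOf_dualChain.2 hs)]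
    simp only [Finsupp.singleAddHom_apply, Finsupp.mapDomain_single]
    rfl
  · rw [chainTerm, chainTerm, dif_neg hs, dif_neg (mt isChainOf_dualChain.1 hs)]
    simp

/-- The two boundaries differ by a sign depending on the degree alone, so cycles and boundaries
correspond. The absolute value only serves to give a parity to the degree -1. -/
lemma reducedBoundary_mapDomain (A : Set X) (G : Type v) [AddCommGroup G] (i j : ℤ)
    (z : Chains A i →₀ G) :
    reducedBoundary (OrderDual.ofDual ⁻¹' A : Set Xᵒᵈ) G i j
        (Finsupp.mapDomain (dualChainsEquiv A i) z) =
      (-1 : ℤ) ^ i.natAbs •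
        Finsupp.mapDomain (dualChainsEquiv A j) (reducedBoundary A G i j z) := by
  classical
  induction z using Finsupp.induction_linear with
  | zero => simp
  | add z w hz hw => simp only [map_add, Finsupp.mapDomain_add, hz, hw, smul_add]
  | single s a =>
    rw [← chainTerm_self, mapDomain_chainTerm,
      reducedBoundary_chainTerm _ _ _ _ _ (isChainOf_dualChain.2 s.2),
      reducedBoundary_chainTerm _ _ _ _ _ s.2]
    rw [show Finsupp.mapDomain (dualChainsEquiv A j) = Finsupp.mapDomain.addMonoidHom (M := G)
      (dualChainsEquiv A j) from rfl, map_sum, Finset.smul_sum]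
    rw [dualChain, Finset.sum_map]
    refine Finset.sum_congr rfl fun w hw => ?_
    rw [map_zsmul, Finsupp.mapDomain.addMonoidHom_apply, mapDomain_chainTerm, dualChain_erase,
      smul_smul]
    have h := faceSign_dualChain s.2.2.1 hw
    have h' : (-1 : ℤ) ^ (s.1.card + 1) = (-1 : ℤ) ^ i.natAbs := by
      have := s.2.2.2
      rcases Nat.even_or_odd (s.1.card + 1) with he | he
      · rw [he.neg_one_pow, Even.neg_one_pow]
        rw [Nat.even_iff] at *
        omega
      · rw [he.neg_one_pow, Odd.neg_one_pow]
        rw [Nat.odd_iff] at *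
        omega
    rw [h'] at h
    rw [← h]
    rfl

/-- Quasicellularity is a condition on the sets Û_x of the opposite poset, while the links F̂_x are
taken in P itself; this passes from the former to the latter. -/
lemma ReducedExact.of_dual {A : Set X} {G : Type v} [AddCommGroup G] {i j k : ℤ}
    (h : ReducedExact (OrderDual.ofDual ⁻¹' A : Set Xᵒᵈ) G i j k) : ReducedExact A G i j k := by
  intro z hz
  have h1 : reducedBoundary (OrderDual.ofDual ⁻¹' A : Set Xᵒᵈ) G j k
      (Finsupp.mapDomain (dualChainsEquiv A j) z) = 0 := by
    rw [reducedBoundary_mapDomain, hz]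
    simp
  obtain ⟨w, hw⟩ := h _ h1
  refine ⟨(-1 : ℤ) ^ i.natAbs • Finsupp.mapDomain (dualChainsEquiv A i).symm w, ?_⟩
  refine Finsupp.mapDomain_injective (dualChainsEquiv A j).injective ?_
  have h2 : Finsupp.mapDomain (dualChainsEquiv A i)
      (Finsupp.mapDomain (dualChainsEquiv A i).symm w) = w := by
    rw [← Finsupp.mapDomain_comp]
    simp
  have h3 := reducedBoundary_mapDomain A G i j (Finsupp.mapDomain (dualChainsEquiv A i).symm w)
  rw [h2, hw] at h3
  rw [h3, map_zsmul]
  exact map_zsmul (Finsupp.mapDomain.addMonoidHom (M := G) (dualChainsEquiv A j)) _ _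

end Exactness

/-! ### Homology of the links F̂_x with arbitrary coefficients. -/

section Quasicellular

variable {P : Type u} [PartialOrder P] {ρ : Pᵒᵈ →o ℕ}

/-- The rank maps a chain of F̂_x injectively into {0, …, ρ(x) - 1}. -/
lemma IsQuasicellularMorphism.card_lt (hρ : IsQuasicellularMorphism ρ) {x : P} {n : ℤ}
    {s : Finset P} (hs : IsChainOf (Set.Ioi x) n s) : n < ρ (OrderDual.toDual x) := by
  have h1 : s.card ≤ (Finset.range (ρ (OrderDual.toDual x))).card :=
    Finset.card_le_card_of_injOn (fun w => ρ (OrderDual.toDual w))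
      (fun w hw => Finset.mem_coe.2 (Finset.mem_range.2
        (hρ.lt (OrderDual.toDual_lt_toDual.2 (hs.1 hw))))) (hρ.injOn hs.2.1)
  rw [Finset.card_range] at h1
  have h2 := hs.2.2
  omega

/-- With arbitrary coefficients, the reduced homology of `F̂_x` is concentrated in degree
`ρ x - 1`. Freeness of the integral homology in that degree is automatic: there are no chains of
higher dimension in `F̂_x`, so this homology is a group of cycles. -/
lemma IsQuasicellularMorphism.reducedExact (hρ : IsQuasicellularMorphism ρ) (x : P)
    (G : Type v) [AddCommGroup G] {i j k : ℤ} (hij : j + 1 = i) (hjk : k + 1 = j)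
    (hj : j ≠ (ρ (OrderDual.toDual x) : ℤ) - 1) : ReducedExact (Set.Ioi x) G i j k := by
  rcases lt_or_gt_of_ne hj with h | h
  · have h0 : ∀ {i j k : ℤ}, j + 1 = i → k + 1 = j → j < (ρ (OrderDual.toDual x) : ℤ) - 1 →
        ReducedExact (Set.Ioi x) ℤ i j k := fun hij hjk hj =>
      ReducedExact.of_dual (reducedExact_of_subsingleton (Set.Iio (OrderDual.toDual x)) ℤ hij hjk
        (hρ.concentrated _ _ hj.ne))
    have hfin : (Set.Ioi x).Finite := by
      refine ((hρ.locallyFinite (OrderDual.toDual x)).preimage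
        (f := OrderDual.toDual) (OrderDual.toDual.injective.injOn)).subset fun y hy => ?_
      exact OrderDual.toDual_le_toDual.2 (le_of_lt (Set.mem_Ioi.1 hy))
    -- Universal coefficients in degree `j` also use the integral vanishing in degree `k = j - 1`,
    -- which lies below ρ(x) - 1 as well.
    exact (h0 hij hjk h).extend hfin hjk
      (h0 (i := j) (j := k) (k := k - 1) hjk (by omega) (by omega)) G
  · intro z _
    have : IsEmpty (Chains (Set.Ioi x) j) := ⟨fun s => by
      have := hρ.card_lt s.2
      omega⟩
    exact ⟨0, Subsingleton.elim _ _⟩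

end Quasicellular

/-! ### Cones over chains of a link. -/

section Cones

variable {P : Type u} [PartialOrder P]

open scoped Classical in
/-- The map `a • s ↦ a • ({x} ∪ s)` from chains of `F̂_x` to chains of `P`. -/
noncomputable def cone (F : P ⥤ AddCommGrpCat.{v}) (x : P) (j i : ℤ) :
    (Chains (Set.Ioi x) j →₀ F.obj x) →+ FunctorChains F i :=
  Finsupp.liftAddHom fun s => functorChainTerm F i (insert x s.1) x

/-- The map `a • s ↦ F(x ≤ min s)(a) • s` from chains of `F̂_x` to chains of `P`. -/
noncomputable def linkInclusion (F : P ⥤ AddCommGrpCat.{v}) (x : P) (j : ℤ) :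
    (Chains (Set.Ioi x) j →₀ F.obj x) →+ FunctorChains F j :=
  Finsupp.liftAddHom fun s => functorChainTerm F j s.1 x

open scoped Classical in
/-- The part of a chain of `P` on simplices with minimum `x`, as a chain of `F̂_x`. -/
noncomputable def linkMap (F : P ⥤ AddCommGrpCat.{v}) (x : P) (i j : ℤ) :
    FunctorChains F i →+ (Chains (Set.Ioi x) j →₀ F.obj x) :=
  DirectSum.toAddMonoid fun σ =>
    if h : chainMin σ = x then
      (chainTerm (Set.Ioi x) (F.obj x) j (σ.1.erase x)).comp (F.map (homOfLE h.le)).hom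
    else 0

open scoped Classical in
lemma cone_chainTerm (F : P ⥤ AddCommGrpCat.{v}) (x : P) (j i : ℤ) {s : Finset P}
    (hs : IsChainOf (Set.Ioi x) j s) (a : F.obj x) :
    cone F x j i (chainTerm _ _ j s a) = functorChainTerm F i (insert x s) x a := by
  rw [chainTerm, dif_pos hs]
  simp [cone]

lemma linkInclusion_chainTerm (F : P ⥤ AddCommGrpCat.{v}) (x : P) (j : ℤ) {s : Finset P}
    (hs : IsChainOf (Set.Ioi x) j s) (a : F.obj x) :
    linkInclusion F x j (chainTerm _ _ j s a) = functorChainTerm F j s x a := by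
  rw [chainTerm, dif_pos hs]
  simp [linkInclusion]

lemma IsChainOf.notMem {x : P} {j : ℤ} {s : Finset P} (hs : IsChainOf (Set.Ioi x) j s) :
    x ∉ s := fun h => lt_irrefl x (hs.1 h)

open scoped Classical in
lemma IsChainOf.isLeast_insert {x : P} {j : ℤ} {s : Finset P} (hs : IsChainOf (Set.Ioi x) j s) :
    IsLeast ((insert x s : Finset P) : Set P) x := by
  refine ⟨by simp, fun w hw => ?_⟩
  rcases Finset.mem_insert.1 (Finset.mem_coe.1 hw) with rfl | h
  · exact le_rfl
  · exact le_of_lt (hs.1 h)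

open scoped Classical in
lemma IsChainOf.isNonemptyChain_insert {x : P} {i j : ℤ} (hij : j + 1 = i) {s : Finset P}
    (hs : IsChainOf (Set.Ioi x) j s) : IsNonemptyChain P i (insert x s) := by
  refine ⟨Finset.insert_nonempty _ _, ?_, ?_⟩
  · rw [Finset.coe_insert]
    exact hs.2.1.insert fun w hw _ => Or.inl (le_of_lt (hs.1 hw))
  · rw [Finset.card_insert_of_notMem hs.notMem]
    have := hs.2.2
    omega

lemma chainMin_eq {n : ℤ} (σ : NonemptyChains P n) {m : P} (hm : IsLeast (σ.1 : Set P) m) :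
    chainMin σ = m :=
  (chainMin_isLeast σ).unique hm

open scoped Classical in
lemma faceSign_insert_self {x : P} {j : ℤ} {s : Finset P} (hs : IsChainOf (Set.Ioi x) j s) :
    faceSign (insert x s) x = 1 := by
  have : (insert x s).filter (fun z => z < x) = ∅ :=
    Finset.filter_eq_empty_iff.2 fun w hw hwx => hwx.not_ge (hs.isLeast_insert.2 hw)
  simp [faceSign, this]

open scoped Classical in
lemma faceSign_insert {x : P} {j : ℤ} {s : Finset P} (hs : IsChainOf (Set.Ioi x) j s) {w : P}
    (hw : w ∈ s) : faceSign (insert x s) w = -faceSign s w := by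
  have h : (insert x s).filter (fun z => z < w) = insert x (s.filter (fun z => z < w)) := by
    rw [Finset.filter_insert, if_pos (Set.mem_Ioi.1 (hs.1 hw))]
  unfold faceSign
  rw [h, Finset.card_insert_of_notMem (fun h => hs.notMem (Finset.mem_of_mem_filter _ h)), pow_succ]
  ring

/-- Deleting the apex, which has position 0, returns the base; every other vertex is shifted by one
position, which accounts for the minus sign. -/
lemma functorBoundary_cone (F : P ⥤ AddCommGrpCat.{v}) (x : P) {i j k : ℤ} (hij : j + 1 = i)
    (hjk : k + 1 = j) (z : Chains (Set.Ioi x) j →₀ F.obj x) :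
    functorBoundary F i j (cone F x j i z) =
      linkInclusion F x j z - cone F x k j (reducedBoundary _ _ j k z) := by
  classical
  induction z using Finsupp.induction_linear with
  | zero => simp
  | add z w hz hw =>
    simp only [map_add, hz, hw]
    abel
  | single s a =>
    have hs := s.2
    rw [← chainTerm_self, cone_chainTerm F x j i hs, linkInclusion_chainTerm F x j hs,
      reducedBoundary_chainTerm _ _ _ _ _ hs,
      functorBoundary_functorChainTerm F i j _ _ (hs.isNonemptyChain_insert hij)
        (fun w hw => hs.isLeast_insert.2 hw),
      Finset.sum_insert hs.notMem, faceSign_insert_self hs, one_smul,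
      Finset.erase_insert hs.notMem, map_sum, sub_eq_add_neg, ← Finset.sum_neg_distrib]
    congr 1
    refine Finset.sum_congr rfl fun w hw => ?_
    have hne : x ≠ w := fun h => hs.notMem (h ▸ hw)
    rw [map_zsmul, cone_chainTerm F x k j (hs.erase hjk hw), faceSign_insert hs hw, neg_smul,
      Finset.erase_insert_of_ne hne]

open scoped Classical in
lemma linkMap_functorChainTerm (F : P ⥤ AddCommGrpCat.{v}) (i j : ℤ) {s : Finset P} {p y : P}
    (hs : IsNonemptyChain P i s) (hy : IsLeast (s : Set P) y) (hp : p ≤ y)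
    (a : F.obj p) :
    linkMap F y i j (functorChainTerm F i s p a) =
      chainTerm (Set.Ioi y) (F.obj y) j (s.erase y) ((F.map (homOfLE hp)).hom a) := by
  have h : chainMin ⟨s, hs⟩ = y := chainMin_eq ⟨s, hs⟩ hy
  rw [functorChainTerm_eq F i s p hs (hp.trans h.ge), linkMap, DirectSum.toAddMonoid_of,
    dif_pos h, AddMonoidHom.comp_apply, ← AddCommGrpCat.comp_apply, ← F.map_comp]
  congr!

open scoped Classical in
lemma linkMap_functorChainTerm_eq_zero (F : P ⥤ AddCommGrpCat.{v}) (i j : ℤ) {s : Finset P}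
    {p y : P} (hy : ¬ IsLeast (s : Set P) y) (a : F.obj p) :
    linkMap F y i j (functorChainTerm F i s p a) = 0 := by
  by_cases h : ∃ hs : IsNonemptyChain P i s, p ≤ chainMin ⟨s, hs⟩
  · obtain ⟨hs, hp⟩ := h
    rw [functorChainTerm_eq F i s p hs hp, linkMap, DirectSum.toAddMonoid_of, dif_neg,
      AddMonoidHom.zero_apply]
    rintro rfl
    exact hy (chainMin_isLeast ⟨s, hs⟩)
  · rw [functorChainTerm, dif_neg h, AddMonoidHom.zero_apply, map_zero]

/-- Together with `linkMap_cone_of_ne`, this lets `linkMap` read off the components of a sum of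
cones with different apices. -/
lemma linkMap_cone_self (F : P ⥤ AddCommGrpCat.{v}) (x : P) {i j : ℤ} (hij : j + 1 = i)
    (z : Chains (Set.Ioi x) j →₀ F.obj x) : linkMap F x i j (cone F x j i z) = z := by
  classical
  induction z using Finsupp.induction_linear with
  | zero => simp
  | add z w hz hw => simp only [map_add, hz, hw]
  | single s a =>
    rw [← chainTerm_self, cone_chainTerm F x j i s.2,
      linkMap_functorChainTerm F i j (s.2.isNonemptyChain_insert hij) s.2.isLeast_insert le_rfl,
      Finset.erase_insert s.2.notMem]
    congr 1
    exact congrArg (fun f => f.hom a) (F.map_id x)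

lemma linkMap_cone_of_ne (F : P ⥤ AddCommGrpCat.{v}) {x y : P} (hxy : x ≠ y) (i j : ℤ)
    (z : Chains (Set.Ioi x) j →₀ F.obj x) : linkMap F y i j (cone F x j i z) = 0 := by
  classical
  induction z using Finsupp.induction_linear with
  | zero => simp
  | add z w hz hw => simp only [map_add, hz, hw, add_zero]
  | single s a =>
    rw [← chainTerm_self, cone_chainTerm F x j i s.2, linkMap_functorChainTerm_eq_zero]
    exact fun h => hxy (s.2.isLeast_insert.unique h)

end Cones

/-! ### The filtration by the rank of the minimum and its quotients. -/

section Filtration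

variable {P : Type u} [PartialOrder P] (ρ : Pᵒᵈ →o ℕ)

/-- The chains of `P` that are supported on simplices whose minimum has rank at most `p`. -/
def rankFiltration (F : P ⥤ AddCommGrpCat.{v}) (p n : ℤ) : AddSubgroup (FunctorChains F n) where
  carrier := {c | ∀ σ : NonemptyChains P n, p < ρ (OrderDual.toDual (chainMin σ)) → c σ = 0}
  zero_mem' _ _ := rfl
  add_mem' {a b} ha hb σ hσ := by rw [DirectSum.add_apply, ha σ hσ, hb σ hσ, add_zero]
  neg_mem' {a} ha σ hσ := by
    change -(a σ) = 0
    rw [ha σ hσ, neg_zero]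

variable {ρ}

lemma rankFiltration_mono (F : P ⥤ AddCommGrpCat.{v}) {p q : ℤ} (hpq : p ≤ q) (n : ℤ) :
    rankFiltration ρ F p n ≤ rankFiltration ρ F q n :=
  fun _ hc σ hσ => hc σ (lt_of_le_of_lt hpq hσ)

open scoped Classical in
lemma of_mem_rankFiltration (F : P ⥤ AddCommGrpCat.{v}) {p n : ℤ} (σ : NonemptyChains P n)
    (hσ : (ρ (OrderDual.toDual (chainMin σ)) : ℤ) ≤ p) (a : F.obj (chainMin σ)) :
    DirectSum.of (fun σ : NonemptyChains P n => F.obj (chainMin σ)) σ a ∈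
      rankFiltration ρ F p n := by
  intro τ hτ
  refine DirectSum.of_eq_of_ne _ _ _ ?_
  rintro rfl
  omega

open scoped Classical in
lemma rankFiltration_le (F : P ⥤ AddCommGrpCat.{v}) {p n : ℤ} {H : AddSubgroup (FunctorChains F n)}
    (h : ∀ (σ : NonemptyChains P n) (a : F.obj (chainMin σ)),
      (ρ (OrderDual.toDual (chainMin σ)) : ℤ) ≤ p →
        DirectSum.of (fun σ : NonemptyChains P n => F.obj (chainMin σ)) σ a ∈ H) :
    rankFiltration ρ F p n ≤ H := by
  intro c hc
  rw [← DirectSum.sum_support_of c]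
  refine H.sum_mem fun σ hσ => h σ _ ?_
  by_contra hlt
  exact (DFinsupp.mem_support_iff.1 hσ) (hc σ (by omega))

/-- The filtration is exhaustive, even if ρ is unbounded, because every chain has finite support. -/
lemma exists_mem_rankFiltration (ρ : Pᵒᵈ →o ℕ) (F : P ⥤ AddCommGrpCat.{v}) {n : ℤ}
    (c : FunctorChains F n) : ∃ k : ℕ, c ∈ rankFiltration ρ F k n := by
  classical
  refine ⟨c.support.sup fun σ => ρ (OrderDual.toDual (chainMin σ)), fun σ hσ => ?_⟩
  by_contra hne
  have := Finset.le_sup (f := fun σ : NonemptyChains P n => ρ (OrderDual.toDual (chainMin σ)))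
    (DFinsupp.mem_support_iff.2 hne)
  simp only at this
  omega

lemma functorChainTerm_mem (F : P ⥤ AddCommGrpCat.{v}) {p n : ℤ} {s : Finset P} {q : P}
    (h : ∀ m, IsLeast (s : Set P) m → (ρ (OrderDual.toDual m) : ℤ) ≤ p) (a : F.obj q) :
    functorChainTerm F n s q a ∈ rankFiltration ρ F p n := by
  by_cases hs : ∃ hs : IsNonemptyChain P n s, q ≤ chainMin ⟨s, hs⟩
  · obtain ⟨hs, hq⟩ := hs
    rw [functorChainTerm_eq F n s q hs hq]
    exact of_mem_rankFiltration F _ (h _ (chainMin_isLeast ⟨s, hs⟩)) _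
  · rw [functorChainTerm, dif_neg hs]
    exact zero_mem _

lemma functorBoundary_mem (F : P ⥤ AddCommGrpCat.{v}) {p i j : ℤ} {c : FunctorChains F i}
    (hc : c ∈ rankFiltration ρ F p i) : functorBoundary F i j c ∈ rankFiltration ρ F p j := by
  classical
  refine rankFiltration_le F (H := (rankFiltration ρ F p j).comap (functorBoundary F i j))
    (fun σ a hσ => ?_) hc
  rw [AddSubgroup.mem_comap, functorBoundary, DirectSum.toAddMonoid_of, AddMonoidHom.finsetSum_apply]
  refine sum_mem fun w _ => ?_
  refine zsmul_mem (functorChainTerm_mem F (fun m hm => ?_) a) _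
  have h1 : chainMin σ ≤ m := (chainMin_isLeast σ).2 (Finset.mem_of_mem_erase hm.1)
  have h2 := ρ.monotone (OrderDual.toDual_le_toDual.2 h1)
  omega

/-- Elements above `x` have strictly smaller rank, so the base of a cone vanishes in the filtration
quotient. -/
lemma linkInclusion_mem (hρ : IsQuasicellularMorphism ρ) (F : P ⥤ AddCommGrpCat.{v}) {p q : ℤ}
    (hpq : q + 1 = p) (x : Level ρ p) (j : ℤ) (z : Chains (Set.Ioi x.1) j →₀ F.obj x.1) :
    linkInclusion F x.1 j z ∈ rankFiltration ρ F q j := by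
  induction z using Finsupp.induction_linear with
  | zero => simp
  | add z w hz hw =>
    rw [map_add]
    exact add_mem hz hw
  | single s a =>
    rw [← chainTerm_self, linkInclusion_chainTerm F _ _ s.2]
    refine functorChainTerm_mem F (fun m hm => ?_) a
    have h1 := hρ.lt (OrderDual.toDual_lt_toDual.2 (s.2.1 hm.1))
    have h2 := x.2
    omega

open scoped Classical in
/-- The sum of the maps `cone F x` over all `x` of rank `p`. -/
noncomputable def coneSum (ρ : Pᵒᵈ →o ℕ) (F : P ⥤ AddCommGrpCat.{v}) (p j i : ℤ) :
    (DirectSum (Level ρ p) fun x => (Chains (Set.Ioi x.1) j →₀ F.obj x.1)) →+ FunctorChains F i :=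
  DirectSum.toAddMonoid fun x => cone F x.1 j i

open scoped Classical in
lemma linkMap_coneSum (F : P ⥤ AddCommGrpCat.{v}) {p i j : ℤ} (hij : j + 1 = i)
    (z : DirectSum (Level ρ p) fun x => (Chains (Set.Ioi x.1) j →₀ F.obj x.1)) (x : Level ρ p) :
    linkMap F x.1 i j (coneSum ρ F p j i z) = z x := by
  induction z using DirectSum.induction_on with
  | zero => simp
  | of y z =>
    rw [coneSum, DirectSum.toAddMonoid_of]
    by_cases hxy : x = y
    · subst hxy
      rw [linkMap_cone_self F x.1 hij, DirectSum.of_eq_same]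
    · rw [linkMap_cone_of_ne F (fun h => hxy (Subtype.ext h.symm)),
        DirectSum.of_eq_of_ne _ _ _ hxy]
  | add z w hz hw => rw [map_add, map_add, hz, hw, DirectSum.add_apply]

lemma linkMap_eq_zero (F : P ⥤ AddCommGrpCat.{v}) {p q i : ℤ} (hpq : q < p) (j : ℤ)
    (x : Level ρ p) {c : FunctorChains F i} (hc : c ∈ rankFiltration ρ F q i) :
    linkMap F x.1 i j c = 0 := by
  classical
  refine rankFiltration_le F (H := (linkMap F x.1 i j).ker) (fun σ a hσ => ?_) hc
  rw [AddMonoidHom.mem_ker, linkMap, DirectSum.toAddMonoid_of, dif_neg, AddMonoidHom.zero_apply]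
  intro h
  have := x.2
  rw [← h] at this
  omega

-- Injectivity of `coneSum` modulo the smaller filtration step; `exists_sub_coneSum_mem` is the
-- surjectivity. Together they identify the filtration quotient with a sum of augmented complexes of
-- links.
open scoped Classical in
lemma eq_zero_of_coneSum_mem (F : P ⥤ AddCommGrpCat.{v}) {p q i j : ℤ} (hpq : q < p)
    (hij : j + 1 = i) {z : DirectSum (Level ρ p) fun x => (Chains (Set.Ioi x.1) j →₀ F.obj x.1)}
    (hz : coneSum ρ F p j i z ∈ rankFiltration ρ F q i) : z = 0 := by
  refine DirectSum.ext fun x => ?_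
  rw [← linkMap_coneSum F hij z x, linkMap_eq_zero F hpq j x hz, DirectSum.zero_apply]

open scoped Classical in
lemma exists_sub_coneSum_mem (F : P ⥤ AddCommGrpCat.{v}) {p q i j : ℤ} (hpq : q + 1 = p)
    (hij : j + 1 = i) {c : FunctorChains F i} (hc : c ∈ rankFiltration ρ F p i) :
    ∃ z, c - coneSum ρ F p j i z ∈ rankFiltration ρ F q i := by
  have h : c ∈ rankFiltration ρ F q i ⊔ (coneSum ρ F p j i).range := by
    refine rankFiltration_le F (fun σ a hσ => ?_) hc
    rcases lt_or_eq_of_le hσ with h | h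
    · exact AddSubgroup.mem_sup_left (of_mem_rankFiltration F σ (by omega) a)
    · refine AddSubgroup.mem_sup_right ?_
      have hmin := chainMin_isLeast σ
      have hs : IsChainOf (Set.Ioi (chainMin σ)) j (σ.1.erase (chainMin σ)) := by
        refine ⟨fun w hw => ?_, σ.2.2.1.mono fun w hw => Finset.mem_of_mem_erase hw, ?_⟩
        · have hw' := Finset.mem_erase.1 (Finset.mem_coe.1 hw)
          exact lt_of_le_of_ne (hmin.2 hw'.2) hw'.1.symm
        · have h1 := Finset.card_erase_add_one hmin.1
          have h2 := σ.2.2.2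
          omega
      refine ⟨DirectSum.of (fun x : Level ρ p => (Chains (Set.Ioi x.1) j →₀ F.obj x.1))
        ⟨chainMin σ, h⟩ (chainTerm _ _ j (σ.1.erase (chainMin σ)) a), ?_⟩
      rw [coneSum, DirectSum.toAddMonoid_of, cone_chainTerm F _ j i hs, Finset.insert_erase hmin.1,
        functorChainTerm_eq F i σ.1 (chainMin σ) σ.2 le_rfl]
      congr 1
      exact congrArg (fun f => f.hom a) (F.map_id (chainMin σ))
  obtain ⟨b, hb, _, ⟨z, rfl⟩, rfl⟩ := AddSubgroup.mem_sup.1 h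
  exact ⟨z, by rwa [add_sub_cancel_right]⟩

open scoped Classical in
/-- Modulo chains of smaller rank, the boundary of a sum of cones is minus the sum of the cones of
the boundaries. -/
lemma functorBoundary_coneSum_add_mem (hρ : IsQuasicellularMorphism ρ) (F : P ⥤ AddCommGrpCat.{v})
    {p q i j k : ℤ} (hpq : q + 1 = p) (hij : j + 1 = i) (hjk : k + 1 = j)
    (z : DirectSum (Level ρ p) fun x => (Chains (Set.Ioi x.1) j →₀ F.obj x.1)) :
    functorBoundary F i j (coneSum ρ F p j i z) + coneSum ρ F p k j
        (DirectSum.map (fun x : Level ρ p => reducedBoundary (Set.Ioi x.1) (F.obj x.1) j k) z) ∈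
      rankFiltration ρ F q j := by
  induction z using DirectSum.induction_on with
  | zero => simp
  | of x z =>
    rw [DirectSum.map_of, coneSum, coneSum, DirectSum.toAddMonoid_of, DirectSum.toAddMonoid_of,
      functorBoundary_cone F x.1 hij hjk, sub_add_cancel]
    exact linkInclusion_mem hρ F hpq x j z
  | add z w hz hw =>
    simp only [map_add]
    rw [add_add_add_comm]
    exact add_mem hz hw

open scoped Classical in
/-- A chain of rank at most `p` whose boundary has smaller rank is, modulo chains of smaller rank,
a sum of cones of cycles. -/
lemma exists_cycle_sub_coneSum_mem (hρ : IsQuasicellularMorphism ρ) (F : P ⥤ AddCommGrpCat.{v})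
    {p q i j k : ℤ} (hpq : q + 1 = p) (hij : j + 1 = i) (hjk : k + 1 = j)
    {c : FunctorChains F i} (hc : c ∈ rankFiltration ρ F p i)
    (hdc : functorBoundary F i j c ∈ rankFiltration ρ F q j) :
    ∃ z, c - coneSum ρ F p j i z ∈ rankFiltration ρ F q i ∧
      DirectSum.map (fun x : Level ρ p => reducedBoundary (Set.Ioi x.1) (F.obj x.1) j k) z = 0 := by
  obtain ⟨z, hz⟩ := exists_sub_coneSum_mem F hpq hij hc
  refine ⟨z, hz, eq_zero_of_coneSum_mem F (show q < p by omega) hjk ?_⟩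
  -- Modulo rank `q`, the cone of the boundary of `z` is minus the boundary of the cone of `z`,
  -- hence minus the boundary of `c`, which vanishes there by hypothesis.
  have h1 := functorBoundary_coneSum_add_mem hρ F hpq hij hjk z
  have h2 := functorBoundary_mem F (j := j) hz
  have h3 := sub_mem (add_mem h1 h2) hdc
  rw [map_sub] at h3
  convert h3 using 1
  abel

/-- The filtration quotients have homology concentrated in degree `p`. -/
lemma exists_sub_functorBoundary_mem (hρ : IsQuasicellularMorphism ρ) (F : P ⥤ AddCommGrpCat.{v})
    {p q h i j : ℤ} (hpq : q + 1 = p) (hhi : i + 1 = h) (hij : j + 1 = i) (hip : i ≠ p)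
    {c : FunctorChains F i} (hc : c ∈ rankFiltration ρ F p i)
    (hdc : functorBoundary F i j c ∈ rankFiltration ρ F q j) :
    ∃ e, c - functorBoundary F h i e ∈ rankFiltration ρ F q i := by
  classical
  obtain ⟨z, hz, hz'⟩ := exists_cycle_sub_coneSum_mem hρ F (k := j - 1) hpq hij (by omega) hc hdc
  have hex : ∀ x : Level ρ p, ∃ w, reducedBoundary (Set.Ioi x.1) (F.obj x.1) i j w = z x := by
    intro x
    refine hρ.reducedExact x.1 (F.obj x.1) hij (k := j - 1) (by omega) ?_ (z x) ?_
    · have := x.2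
      omega
    · rw [← DirectSum.map_apply (fun x : Level ρ p =>
        reducedBoundary (Set.Ioi x.1) (F.obj x.1) j (j - 1)), hz']
      rfl
  choose w hw using hex
  -- The chosen `w x` may be nonzero for infinitely many `x`; restricting to the support of `z`
  -- gives an element of the direct sum with the same boundary.
  let W : DirectSum (Level ρ p) fun x => (Chains (Set.Ioi x.1) i →₀ F.obj x.1) :=
    ∑ x ∈ z.support, DirectSum.of (fun x : Level ρ p => (Chains (Set.Ioi x.1) i →₀ F.obj x.1)) x (w x)
  have hW : DirectSum.map (fun x : Level ρ p => reducedBoundary (Set.Ioi x.1) (F.obj x.1) i j) W =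
      z := by
    rw [map_sum]
    conv_rhs => rw [← DirectSum.sum_support_of z]
    refine Finset.sum_congr rfl fun x _ => ?_
    rw [DirectSum.map_of, hw]
  -- The sign compensates the one in the boundary of a cone.
  refine ⟨-coneSum ρ F p i h W, ?_⟩
  have h1 := functorBoundary_coneSum_add_mem hρ F hpq hhi hij W
  rw [hW] at h1
  convert add_mem hz h1 using 1
  rw [map_neg]
  abel

/-- Descent through the filtration: each step from rank i + k + 1 to i + k takes place in a quotient
without homology in degree i. Subtracting boundaries leaves dc unchanged, so the hypothesis
persists. -/
lemma exists_sub_functorBoundary_mem_degree (hρ : IsQuasicellularMorphism ρ)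
    (F : P ⥤ AddCommGrpCat.{v}) {h i j : ℤ} (hhi : i + 1 = h) (hij : j + 1 = i)
    (c : FunctorChains F i) (hdc : functorBoundary F i j c ∈ rankFiltration ρ F i j) :
    ∃ e, c - functorBoundary F h i e ∈ rankFiltration ρ F i i := by
  have key : ∀ (k : ℕ) (c : FunctorChains F i), c ∈ rankFiltration ρ F (i + k) i →
      functorBoundary F i j c ∈ rankFiltration ρ F i j →
        ∃ e, c - functorBoundary F h i e ∈ rankFiltration ρ F i i := by
    intro k
    induction k with
    | zero =>
      intro c hc _
      exact ⟨0, by simpa using hc⟩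
    | succ k ih =>
      intro c hc hdc
      obtain ⟨e, he⟩ := exists_sub_functorBoundary_mem hρ F (q := i + k)
        (p := i + (k + 1 : ℕ)) (by push_cast; ring) hhi hij (by push_cast; omega) hc
        (rankFiltration_mono F (by omega) _ hdc)
      have h2 : functorBoundary F i j (functorBoundary F h i e) = 0 :=
        DFunLike.congr_fun (functorBoundary_comp F h i j hhi) e
      obtain ⟨e', he'⟩ := ih _ he (by rwa [map_sub, h2, sub_zero])
      exact ⟨e + e', by rwa [map_add, ← sub_sub]⟩
  obtain ⟨m, hm⟩ := exists_mem_rankFiltration ρ F c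
  -- Adding |i| ensures that the starting rank i + (m + |i|) is at least m when i is negative.
  exact key (m + i.natAbs) c (rankFiltration_mono F (by omega) _ hm) hdc

lemma IsQuasicellularMorphism.le_rank_chainMin (hρ : IsQuasicellularMorphism ρ) {n : ℤ}
    (σ : NonemptyChains P n) : n ≤ ρ (OrderDual.toDual (chainMin σ)) := by
  classical
  have hmin := chainMin_isLeast σ
  have h := hρ.card_lt (x := chainMin σ) (n := n - 1) (s := σ.1.erase (chainMin σ)) ?_
  · omega
  refine ⟨fun w hw => ?_, σ.2.2.1.mono fun w hw => Finset.mem_of_mem_erase hw, ?_⟩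
  · have hw' := Finset.mem_erase.1 (Finset.mem_coe.1 hw)
    exact lt_of_le_of_ne (hmin.2 hw'.2) hw'.1.symm
  · have h1 := Finset.card_erase_add_one hmin.1
    have h2 := σ.2.2.2
    omega

/-- The filtration of the degree n part starts at rank n: the minimum of an n-simplex has n elements
above it in a chain. -/
lemma eq_zero_of_mem_rankFiltration (hρ : IsQuasicellularMorphism ρ) (F : P ⥤ AddCommGrpCat.{v})
    {p n : ℤ} (hpn : p < n) {c : FunctorChains F n} (hc : c ∈ rankFiltration ρ F p n) : c = 0 :=
  DirectSum.ext fun σ => hc σ (lt_of_lt_of_le hpn (hρ.le_rank_chainMin σ))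

end Filtration

/-! ### Quasi-isomorphisms of short complexes, tested on elements. -/

section QuasiIso

lemma exists_iCycles_eq (S : ShortComplex AddCommGrpCat.{v}) (x : S.X₂) (hx : S.g.hom x = 0) :
    ∃ z : S.cycles, S.iCycles.hom z = x :=
  ⟨S.abCyclesIso.inv ⟨x, hx⟩, S.abCyclesIso_inv_apply_iCycles ⟨x, hx⟩⟩

lemma iCycles_injective (S : ShortComplex AddCommGrpCat.{v}) : Function.Injective S.iCycles.hom :=
  (AddCommGrpCat.mono_iff_injective S.iCycles).1 inferInstance

lemma homologyπ_surjective (S : ShortComplex AddCommGrpCat.{v}) :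
    Function.Surjective S.homologyπ.hom :=
  (AddCommGrpCat.epi_iff_surjective S.homologyπ).1 inferInstance

lemma homologyπ_eq_zero_iff (S : ShortComplex AddCommGrpCat.{v}) (z : S.cycles) :
    S.homologyπ.hom z = 0 ↔ ∃ y, S.f.hom y = S.iCycles.hom z := by
  have h1 : ∀ y, S.iCycles.hom (S.toCycles.hom y) = S.f.hom y := fun y =>
    congrArg (fun f => f.hom y) S.toCycles_i
  constructor
  · intro hz
    have h := (ShortComplex.mk _ _ S.toCycles_comp_homologyπ).exact_of_g_is_cokernel
      S.homologyIsCokernel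
    obtain ⟨y, hy⟩ := (ShortComplex.ab_exact_iff _).1 h z hz
    exact ⟨y, by rw [← h1]; exact congrArg S.iCycles.hom hy⟩
  · rintro ⟨y, hy⟩
    rw [← h1] at hy
    rw [← iCycles_injective S hy]
    exact congrArg (fun f => f.hom y) S.toCycles_comp_homologyπ

lemma quasiIso_of_elements {S T : ShortComplex AddCommGrpCat.{v}} (φ : S ⟶ T)
    (hinj : ∀ x, S.g.hom x = 0 → ∀ y, φ.τ₂.hom x = T.f.hom y → ∃ w, S.f.hom w = x)
    (hsurj : ∀ y, T.g.hom y = 0 → ∃ x w, S.g.hom x = 0 ∧ φ.τ₂.hom x = y - T.f.hom w) :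
    ShortComplex.QuasiIso φ := by
  have hπ : ∀ z, (ShortComplex.homologyMap φ).hom (S.homologyπ.hom z) =
      T.homologyπ.hom ((ShortComplex.cyclesMap φ).hom z) := fun z =>
    congrArg (fun f => f.hom z) (ShortComplex.homologyπ_naturality φ)
  have hi : ∀ z, T.iCycles.hom ((ShortComplex.cyclesMap φ).hom z) =
      φ.τ₂.hom (S.iCycles.hom z) := fun z =>
    congrArg (fun f => f.hom z) (ShortComplex.cyclesMap_i φ)
  have hg : ∀ (U : ShortComplex AddCommGrpCat.{v}) z, U.g.hom (U.iCycles.hom z) = 0 := fun U z =>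
    congrArg (fun f => f.hom z) U.iCycles_g
  rw [ShortComplex.quasiIso_iff, ConcreteCategory.isIso_iff_bijective]
  constructor
  · refine (injective_iff_map_eq_zero (ShortComplex.homologyMap φ).hom).2 fun c hc => ?_
    obtain ⟨z, rfl⟩ := homologyπ_surjective S c
    rw [hπ, homologyπ_eq_zero_iff] at hc
    obtain ⟨y, hy⟩ := hc
    rw [hi] at hy
    exact (homologyπ_eq_zero_iff S z).2 (hinj _ (hg S z) y hy.symm)
  · intro c
    obtain ⟨z, rfl⟩ := homologyπ_surjective T c
    obtain ⟨x, w, hx, hxw⟩ := hsurj _ (hg T z)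
    obtain ⟨t, rfl⟩ := exists_iCycles_eq S x hx
    refine ⟨S.homologyπ.hom t, (hπ t).trans ?_⟩
    rw [← sub_eq_zero, ← map_sub, homologyπ_eq_zero_iff]
    refine ⟨-w, ?_⟩
    rw [map_sub, hi, hxw, map_neg]
    abel

end QuasiIso

/-! ### The comparison map and its quasi-isomorphism property. -/

section Comparison

variable {P : Type u} [PartialOrder P] {ρ : Pᵒᵈ →o ℕ}

/-- A link of an element of rank n has no n-chains, hence no nonzero boundaries in degree n - 1. -/
lemma IsQuasicellularMorphism.sc_f_eq_zero (hρ : IsQuasicellularMorphism ρ)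
    (F : P ⥤ AddCommGrpCat.{v}) {n : ℤ} (x : Level ρ n) : (augPart F x.1 (n - 1)).f = 0 := by
  have : IsEmpty (Chains (Set.Ioi x.1) ((ComplexShape.down ℤ).prev (n - 1))) := ⟨fun s => by
    have h1 := hρ.card_lt s.2
    have h2 := x.2
    have h3 : (ComplexShape.down ℤ).prev (n - 1) = n := (ComplexShape.down ℤ).prev_eq' (by simp)
    omega⟩
  refine AddCommGrpCat.hom_ext (AddMonoidHom.ext fun z => ?_)
  have hz : z = 0 := Subsingleton.elim
    (α := Chains (Set.Ioi x.1) ((ComplexShape.down ℤ).prev (n - 1)) →₀ F.obj x.1) z 0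
  exact (congrArg (augPart F x.1 (n - 1)).f.hom hz).trans (map_zero _)

/-- In the top degree a homology class of `F̂_x` is the same as a cycle. -/
noncomputable def classToChain (hρ : IsQuasicellularMorphism ρ) (F : P ⥤ AddCommGrpCat.{v}) {n : ℤ}
    (x : Level ρ n) :
    reducedHomology (Set.Ioi x.1) (F.obj x.1) (n - 1) →+
      (Chains (Set.Ioi x.1) (n - 1) →₀ F.obj x.1) :=
  ((augPart F x.1 (n - 1)).homologyι ≫ (augPart F x.1 (n - 1)).descOpcycles (𝟙 _)
    (by rw [hρ.sc_f_eq_zero F x, Limits.zero_comp])).hom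

lemma classToChain_homologyπ (hρ : IsQuasicellularMorphism ρ) (F : P ⥤ AddCommGrpCat.{v}) {n : ℤ}
    (x : Level ρ n) (z : (augPart F x.1 (n - 1)).cycles) :
    classToChain hρ F x ((augPart F x.1 (n - 1)).homologyπ.hom z) =
      (augPart F x.1 (n - 1)).iCycles.hom z := by
  have h : (augPart F x.1 (n - 1)).homologyπ ≫ (augPart F x.1 (n - 1)).homologyι ≫
      (augPart F x.1 (n - 1)).descOpcycles (𝟙 _)
        (by rw [hρ.sc_f_eq_zero F x, Limits.zero_comp]) = (augPart F x.1 (n - 1)).iCycles := by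
    simp
  exact congrArg (fun f => f.hom z) h

lemma classToChain_injective (hρ : IsQuasicellularMorphism ρ) (F : P ⥤ AddCommGrpCat.{v}) {n : ℤ}
    (x : Level ρ n) : Function.Injective (classToChain hρ F x) := by
  refine (injective_iff_map_eq_zero _).2 fun c hc => ?_
  obtain ⟨z, rfl⟩ := exists_cycle _ _ c
  rw [classToChain_homologyπ] at hc
  have : z = 0 := iCycles_injective _ (hc.trans (map_zero _).symm)
  rw [this]
  exact map_zero _

lemma reducedBoundary_classToChain (hρ : IsQuasicellularMorphism ρ) (F : P ⥤ AddCommGrpCat.{v})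
    {n k : ℤ} (hk : k + 1 = n - 1) (x : Level ρ n)
    (c : reducedHomology (Set.Ioi x.1) (F.obj x.1) (n - 1)) :
    reducedBoundary _ _ (n - 1) k (classToChain hρ F x c) = 0 := by
  obtain ⟨z, rfl⟩ := exists_cycle _ _ c
  rw [classToChain_homologyπ]
  exact reducedBoundary_iCycles F x.1 _ _ hk z

lemma exists_classToChain_eq (hρ : IsQuasicellularMorphism ρ) (F : P ⥤ AddCommGrpCat.{v})
    {n k : ℤ} (hk : k + 1 = n - 1) (x : Level ρ n)
    (z : Chains (Set.Ioi x.1) (n - 1) →₀ F.obj x.1) (hz : reducedBoundary _ _ (n - 1) k z = 0) :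
    ∃ c, classToChain hρ F x c = z := by
  obtain rfl : (ComplexShape.down ℤ).next (n - 1) = k := (ComplexShape.down ℤ).next_eq' hk
  obtain ⟨w, hw⟩ := exists_iCycles_eq (augPart F x.1 (n - 1)) z hz
  exact ⟨_, (classToChain_homologyπ hρ F x w).trans hw⟩

lemma classToChain_cellularEntry (hρ : IsQuasicellularMorphism ρ) (F : P ⥤ AddCommGrpCat.{v})
    {i j : ℤ} (hij : j + 1 = i) (x : Level ρ i) (y : Level ρ j)
    (c : reducedHomology (Set.Ioi x.1) (F.obj x.1) (i - 1)) :
    classToChain hρ F y ((cellularEntry hρ F hij x y).hom c) =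
      deleteMap F x.1 y.1 (i - 1) (j - 1) (classToChain hρ F x c) := by
  obtain ⟨z, rfl⟩ := exists_cycle _ _ c
  rw [classToChain_homologyπ]
  refine (congrArg _ (cellularEntry_homologyπ hρ F hij x y z)).trans ?_
  rw [classToChain_homologyπ, iCycles_cyclesMap]

/-- A chain of dimension `i - 1` in `F̂_x`, `x ∈ D_i`, is the cone with apex its minimum, which lies
in `D_{i-1}`. -/
lemma linkInclusion_eq_sum (hρ : IsQuasicellularMorphism ρ) (F : P ⥤ AddCommGrpCat.{v})
    {i j : ℤ} (hij : j + 1 = i) (x : Level ρ i)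
    (z : Chains (Set.Ioi x.1) (i - 1) →₀ F.obj x.1) :
    linkInclusion F x.1 (i - 1) z = ∑ y ∈ (hρ.finite_above x.1 j).toFinset,
      cone F y.1 (j - 1) (i - 1) (deleteMap F x.1 y.1 (i - 1) (j - 1) z) := by
  classical
  induction z using Finsupp.induction_linear with
  | zero => simp
  | add z w hz hw => simp only [map_add, hz, hw, Finset.sum_add_distrib]
  | single s a =>
    have hs := s.2
    rw [← chainTerm_self, linkInclusion_chainTerm F _ _ hs]
    have h1 : ∀ y ∈ (hρ.finite_above x.1 j).toFinset, y.1 ∈ s.1 →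
        cone F y.1 (j - 1) (i - 1) (deleteMap F x.1 y.1 (i - 1) (j - 1)
          (chainTerm _ _ (i - 1) s.1 a)) = functorChainTerm F (i - 1) s.1 x.1 a := by
      intro y hy hys
      have hxy : x.1 < y.1 := by simpa using hy
      have hs' := hs.erase_of_covBy (hρ.covBy hij x y hxy) (j := j - 1) (by omega) hys
      rw [deleteMap_chainTerm F _ _ hxy _ _ _ hs, if_pos hys, cone_chainTerm F _ _ _ hs',
        functorChainTerm_map]
      · rw [Finset.insert_erase hys]
      · exact fun w hw => hs'.isLeast_insert.2 (Finset.mem_coe.2 hw)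
    have h2 : ∀ y ∈ (hρ.finite_above x.1 j).toFinset, y.1 ∉ s.1 →
        cone F y.1 (j - 1) (i - 1) (deleteMap F x.1 y.1 (i - 1) (j - 1)
          (chainTerm _ _ (i - 1) s.1 a)) = 0 := by
      intro y hy hys
      have hxy : x.1 < y.1 := by simpa using hy
      rw [deleteMap_chainTerm F _ _ hxy _ _ _ hs, if_neg hys, map_zero]
    by_cases hne : s.1.Nonempty
    -- The i elements of `s` take all the ranks below i, so exactly one of them has rank j and only
    -- its summand survives.
    · obtain ⟨m, hm, hmj⟩ := hρ.exists_level hij x hs hne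
      have hmem : (⟨m, hmj⟩ : Level ρ j) ∈ (hρ.finite_above x.1 j).toFinset := by
        simpa using hs.1 hm
      rw [Finset.sum_eq_single_of_mem _ hmem, h1 _ hmem hm]
      intro y hy hym
      refine h2 y hy fun hys => hym (Subtype.ext (hρ.injOn hs.2.1 hys hm ?_))
      have := y.2
      change ρ (OrderDual.toDual y.1) = ρ (OrderDual.toDual m)
      omega
    -- The empty chain, in degree -1, is sent to zero on both sides, since C(P; F) is not augmented.
    · rw [functorChainTerm_eq_zero F _ _ _ (fun h => hne h.1), AddMonoidHom.zero_apply]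
      exact (Finset.sum_eq_zero fun y hy => h2 y hy fun h => hne ⟨_, h⟩).symm

/-- The map from cellular chains to chains of `P` that takes a class of `F̂_x` to the cone with apex
`x` on the cycle that represents it. -/
noncomputable def cellularToFunctor (hρ : IsQuasicellularMorphism ρ) (F : P ⥤ AddCommGrpCat.{v})
    (n : ℤ) : CellularChains ρ F n →+ FunctorChains F n :=
  (coneSum ρ F n (n - 1) n).comp (DirectSum.map fun x => classToChain hρ F x)

open scoped Classical in
lemma cellularToFunctor_of (hρ : IsQuasicellularMorphism ρ) (F : P ⥤ AddCommGrpCat.{v})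
    {n : ℤ} (x : Level ρ n) (c : reducedHomology (Set.Ioi x.1) (F.obj x.1) (n - 1)) :
    cellularToFunctor hρ F n
        (DirectSum.of (fun x : Level ρ n => reducedHomology (Set.Ioi x.1) (F.obj x.1) (n - 1)) x c) =
      cone F x.1 (n - 1) n (classToChain hρ F x c) := by
  rw [cellularToFunctor, AddMonoidHom.comp_apply, DirectSum.map_of, coneSum,
    DirectSum.toAddMonoid_of]

/-- The boundary of a cone over a cycle is its base, and by `linkInclusion_eq_sum` the base regroups
into cones with apices in D_{i-1}. This is where the formula for the cellular differential comes
from. -/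
lemma functorBoundary_cellularToFunctor (hρ : IsQuasicellularMorphism ρ)
    (F : P ⥤ AddCommGrpCat.{v}) {i j : ℤ} (hij : j + 1 = i) :
    (functorBoundary F i j).comp (cellularToFunctor hρ F i) =
      (cellularToFunctor hρ F j).comp (cellularBoundary hρ F hij) := by
  classical
  refine DirectSum.addHom_ext fun x c => ?_
  obtain rfl : j = i - 1 := by omega
  rw [AddMonoidHom.comp_apply, AddMonoidHom.comp_apply, cellularToFunctor_of,
    functorBoundary_cone F x.1 (k := i - 1 - 1) hij (by omega),
    reducedBoundary_classToChain hρ F (by omega), map_zero, sub_zero,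
    linkInclusion_eq_sum hρ F hij, cellularBoundary, DirectSum.toAddMonoid_of]
  simp only [AddMonoidHom.finsetSum_apply, AddMonoidHom.comp_apply, map_sum]
  refine Finset.sum_congr rfl fun y _ => ?_
  rw [cellularToFunctor_of, classToChain_cellularEntry]

lemma cellularToFunctor_injective (hρ : IsQuasicellularMorphism ρ) (F : P ⥤ AddCommGrpCat.{v})
    (n : ℤ) : Function.Injective (cellularToFunctor hρ F n) := by
  classical
  have h : Function.Injective (coneSum ρ F n (n - 1) n) := by
    intro z w hzw
    refine DirectSum.ext fun x => ?_
    rw [← linkMap_coneSum F (i := n) (by omega) z x, hzw, linkMap_coneSum F (by omega)]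
  exact h.comp ((DirectSum.map_injective _).2 fun x => classToChain_injective hρ F x)

lemma cellularToFunctor_mem (hρ : IsQuasicellularMorphism ρ) (F : P ⥤ AddCommGrpCat.{v})
    {n : ℤ} (c : CellularChains ρ F n) :
    cellularToFunctor hρ F n c ∈ rankFiltration ρ F n n := by
  classical
  induction c using DirectSum.induction_on with
  | zero => simp
  | of x c =>
    rw [cellularToFunctor_of]
    induction classToChain hρ F x c using Finsupp.induction_linear with
    | zero => simp
    | add z w hz hw =>
      rw [map_add]
      exact add_mem hz hw
    | single s a =>
      rw [← chainTerm_self, cone_chainTerm F _ _ _ s.2]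
      refine functorChainTerm_mem F (fun m hm => ?_) a
      rw [hm.unique s.2.isLeast_insert, x.2]
  | add c d hc hd =>
    rw [map_add]
    exact add_mem hc hd

/-- Such a chain is a sum of cones over cycles up to an n-chain of rank at most n - 1, and the
latter is zero. Cycles in the top degree of the links are homology classes. -/
lemma exists_cellularToFunctor_eq (hρ : IsQuasicellularMorphism ρ) (F : P ⥤ AddCommGrpCat.{v})
    {n k : ℤ} (hk : k + 1 = n) {c : FunctorChains F n} (hc : c ∈ rankFiltration ρ F n n)
    (hdc : functorBoundary F n k c ∈ rankFiltration ρ F k k) :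
    ∃ a, cellularToFunctor hρ F n a = c := by
  classical
  obtain rfl : k = n - 1 := by omega
  obtain ⟨z, hz, hz'⟩ := exists_cycle_sub_coneSum_mem hρ F (k := n - 1 - 1) hk hk (by omega) hc hdc
  have hz0 := eq_zero_of_mem_rankFiltration hρ F (by omega) hz
  have hex : ∀ x : Level ρ n, ∃ a, classToChain hρ F x a = z x := by
    intro x
    refine exists_classToChain_eq hρ F (k := n - 1 - 1) (by omega) x (z x) ?_
    rw [← DirectSum.map_apply (fun x : Level ρ n =>
      reducedBoundary (Set.Ioi x.1) (F.obj x.1) (n - 1) (n - 1 - 1)), hz']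
    rfl
  choose a ha using hex
  refine ⟨∑ x ∈ z.support, DirectSum.of (fun x : Level ρ n =>
    reducedHomology (Set.Ioi x.1) (F.obj x.1) (n - 1)) x (a x), ?_⟩
  rw [sub_eq_zero.1 hz0, map_sum]
  conv_rhs => rw [← DirectSum.sum_support_of z, map_sum]
  refine Finset.sum_congr rfl fun x _ => ?_
  rw [cellularToFunctor_of, ha, coneSum, DirectSum.toAddMonoid_of]

/-- The comparison map from the cellular complex to the complex `C(P; F)`. -/
noncomputable def cellularComparison (hρ : IsQuasicellularMorphism ρ) (F : P ⥤ AddCommGrpCat.{v}) :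
    cellularComplex hρ F ⟶ functorComplex F where
  f n := AddCommGrpCat.ofHom (cellularToFunctor hρ F n)
  comm' i j hij := by
    have hij' : j + 1 = i := hij
    have h : (cellularComplex hρ F).d i j = AddCommGrpCat.ofHom (cellularBoundary hρ F hij') :=
      dif_pos hij'
    rw [h]
    exact congrArg AddCommGrpCat.ofHom (functorBoundary_cellularToFunctor hρ F hij')

lemma quasiIsoAt_cellularComparison (hρ : IsQuasicellularMorphism ρ) (F : P ⥤ AddCommGrpCat.{v})
    (n : ℤ) : QuasiIsoAt (cellularComparison hρ F) n := by
  rw [quasiIsoAt_iff' _ (n + 1) n (n - 1) ((ComplexShape.down ℤ).prev_eq' rfl)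
    ((ComplexShape.down ℤ).next_eq' (sub_add_cancel n 1))]
  have hd : ∀ {i j : ℤ} (hij : j + 1 = i), ((cellularComplex hρ F).d i j).hom =
      cellularBoundary hρ F hij := fun hij => by
    have h : (cellularComplex hρ F).d _ _ = AddCommGrpCat.ofHom (cellularBoundary hρ F hij) :=
      dif_pos hij
    rw [h]
    rfl
  have hcomm : ∀ {i j : ℤ} (hij : j + 1 = i) (a : CellularChains ρ F i),
      functorBoundary F i j (cellularToFunctor hρ F i a) =
        cellularToFunctor hρ F j (cellularBoundary hρ F hij a) := fun hij a =>
    DFunLike.congr_fun (functorBoundary_cellularToFunctor hρ F hij) a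
  have hdd : ∀ {i j k : ℤ} (_ : j + 1 = i) (e : FunctorChains F i),
      functorBoundary F j k (functorBoundary F i j e) = 0 := fun hij e =>
    DFunLike.congr_fun (functorBoundary_comp F _ _ _ hij) e
  refine quasiIso_of_elements _ ?_ ?_
  · intro (a : CellularChains ρ F n) _ (e : FunctorChains F (n + 1))
      (hae : cellularToFunctor hρ F n a = functorBoundary F (n + 1) n e)
    -- Injectivity: the bounding chain `e` is changed by a boundary until its rank is at most n + 1.
    -- It then comes from a cellular chain `b`, and injectivity of the comparison map in degree n
    -- gives `a` as the boundary of `b`.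
    obtain ⟨e', he'⟩ := exists_sub_functorBoundary_mem_degree hρ F (h := n + 1 + 1) rfl rfl e
      (hae ▸ rankFiltration_mono F (by omega) _ (cellularToFunctor_mem hρ F a))
    have hd' : functorBoundary F (n + 1) n (e - functorBoundary F (n + 1 + 1) (n + 1) e') =
        cellularToFunctor hρ F n a := by
      rw [map_sub, hdd rfl, sub_zero, hae]
    obtain ⟨b, hb⟩ := exists_cellularToFunctor_eq hρ F rfl he'
      (hd' ▸ cellularToFunctor_mem hρ F a)
    refine ⟨b, ?_⟩
    refine (DFunLike.congr_fun (hd (i := n + 1) (j := n) rfl) b).trans ?_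
    refine cellularToFunctor_injective hρ F n ?_
    exact (hcomm rfl b).symm.trans ((congrArg _ hb).trans hd')
  · intro (c : FunctorChains F n) (hc : functorBoundary F n (n - 1) c = 0)
    -- Surjectivity: the cycle `c` is homologous to a cycle of rank at most n, which is the image of
    -- a cellular chain; that chain is a cycle because the comparison map is injective in degree n -
    -- 1.
    obtain ⟨e, he⟩ := exists_sub_functorBoundary_mem_degree hρ F (h := n + 1) (j := n - 1) rfl
      (by omega) c (hc ▸ zero_mem _)
    have hd' : functorBoundary F n (n - 1) (c - functorBoundary F (n + 1) n e) = 0 := by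
      rw [map_sub, hdd rfl, sub_zero, hc]
    obtain ⟨a, ha⟩ := exists_cellularToFunctor_eq hρ F (k := n - 1) (by omega) he
      (hd' ▸ zero_mem _)
    refine ⟨a, e, ?_, ha⟩
    refine (DFunLike.congr_fun (hd (i := n) (j := n - 1) (by omega)) a).trans ?_
    refine cellularToFunctor_injective hρ F (n - 1) ?_
    exact ((hcomm _ a).symm.trans ((congrArg _ ha).trans hd')).trans (map_zero _).symm

end Comparison

end PosetHomology

theorem mainTheorem1 {P : Type u} [PartialOrder P] (ρ : Pᵒᵈ →o ℕ)
    (hρ : PosetHomology.IsQuasicellularMorphism ρ)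
    (hfree : ∀ x : Pᵒᵈ,
      Module.Free ℤ (PosetHomology.reducedHomology (Set.Iio x) ℤ ((ρ x : ℤ) - 1)))
    (F : P ⥤ AddCommGrpCat.{v}) (n : ℤ) :
    Nonempty (PosetHomology.functorHomology F n ≅
      (PosetHomology.cellularComplex hρ F).homology n) := by
  have := PosetHomology.quasiIsoAt_cellularComparison hρ F n
  exact ⟨(isoOfQuasiIsoAt (PosetHomology.cellularComparison hρ F) n).symm⟩
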